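/- **Model.** Let $V$ be a finite set of nodes, identified with their linearly ordered ids. Each node $u$ has variables: lists $u.L$, $u.R$ of ids (left and right *shortcuts*; the $i$-th entries, $i\ge 1$, are denoted $u.S_l(i)$, $u.S_r(i)$; $u.S$ is the set of all entries), integers $u.\mathit{vID}$, $u.\text{c-par}$, $u.\text{c-dist}$, $u.t$, $u.\mathit{dist}$, an id $u.\mathit{flyID}$, a bit $u.\mathit{exit}$, a finite set $u.\text{c-ids}$ of ids, a memory of an arbitrary base algorithm $\mathcal A_0$ (with its own messages), and a channel of received messages. Flushing ids means storing them in the memory of $\mathcal A_0$; $\mathrm{Rej}(I)$ means: send RejFlyover to all ids in $I$ and flush $I$. For $x\ge 1$ with $x\neq u.\mathit{vID}\ge 1$, $\mathrm{NextStop}_u(x)$ is the shortcut $u.S_r(i)$ with $|u.\mathit{vID}+2^{i-1}-x|$ minimal if $x>u.\mathit{vID}$, and the $u.S_l(i)$ with $|u.\mathit{vID}-2^{i-1}-x|$ minimal if $x<u.\mathit{vID}$ (smallest such $i$); it is undefined in all other cases and if there is no shortcut on that side. Let $\mathrm{prop}_u$ be the condition $u.\mathit{vID}=1\lor(u.\mathit{vID}>1\land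 u.\mathit{flyID}\ne u)$. Rounds are synchronous and numbered $1,2,\dots$; the configuration at the start of round 1 (variables and channels) is arbitrary. A message sent in a round is in the recipient's channel at the start of the next round, in arbitrary order, together with arbitrary RequestSnapshot and Advice messages of a possibly malicious supervisor. In a round every node $u$ does the following, in this order. (a) *Checks.* Set $u.\mathit{exit}=1$ if the channel has a RejFlyover message, or one of these holds: $u.S=\emptyset\land(u.\text{c-ids}\neq\emptyset\lor u.\mathit{flyID}\ne u)$; $u.L\ne\emptyset\land u.\mathit{vID}\le1$; $u.L=\emptyset\neq u.R\land(u.\mathit{vID}\ne1\lor u.\mathit{flyID}\ne u)$; $u.\mathit{vID}=1\land u.\text{c-dist}\ne0$; $u.\mathit{vID}>1\land u.\text{c-dist}\le0$; $u.S\ne\emptyset\land u.\mathit{vID}>1\land\mathrm{NextStop}_u(u.\text{c-par})$ undefined; $|u.\text{c-ids}|>2$; $|u.\text{c-ids}|=2$ and $u$ is larger than both or smaller than both elements. If now $u.\mathit{exit}=1$, then $\mathrm{Rej}((u.S\cup\{u.\mathit{flyID}\}\cup u.\text{c-ids})\setminus\{u\})$, and reset $u.L=u.R=\emptyset$, $u.\mathit{vID}=0$,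 $u.\mathit{flyID}=u$, $u.\mathit{exit}=0$, $u.\text{c-par}=0$, $u.\text{c-dist}=-1$, $u.\text{c-ids}=\emptyset$. (b) *Responses*, kind by kind, for each received message. TestLine-R$(x)$: if not ($u.L\neq\emptyset$ and $u.S_l(1)=x$), set $u.\mathit{exit}=1$; if $u.S=\emptyset$ or $u.\mathit{exit}=1$, $\mathrm{Rej}(\{x\})$. FlyConst-R$(w,i,x)$: if $u.L=\emptyset$, or $|u.L|\ge i$ and $u.S_l(i)\ne x$, or $|u.L|\ge i+1$ and $u.S_l(i+1)\neq w$, set $u.\mathit{exit}=1$; if $u.\mathit{exit}=0$ and $1<|u.L|<i$, flush $\{x,w\}$; if $u.\mathit{exit}=0$, $|u.L|=i$ and $u.S_l(i)=x$, append $w$ to $u.L$; if $u.S=\emptyset$ or $u.\mathit{exit}=1$, $\mathrm{Rej}(\{x,w\})$. TestLine-L and FlyConst-L: the same with $R,S_r$ in place of $L,S_l$. TestvID$(x)$: if $u.S=\emptyset$ or $u.\mathit{vID}\neq x$, set $u.\mathit{exit}=1$. TestFlyID$(f)$, $f$ an id or $\bot$: if $u.L\neq\emptyset$, $u.\mathit{exit}=0$,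 $u.\mathit{flyID}=u$ and $f\ne\bot$, set $u.\mathit{flyID}=f$; then if ($u.S\ne\emptyset$ and $u.\mathit{flyID}\ne f$) or ($u.S=\emptyset$ and $f\neq\bot$), set $u.\mathit{exit}=1$; if $u.\mathit{exit}=1$ and $f\neq\bot$, $\mathrm{Rej}(\{f\})$. TestCert$(w,x,d)$: if $u.\mathit{vID}=x$ and $d-1\neq u.\text{c-dist}$, or $u.\mathit{vID}\ne x$ and $\mathrm{NextStop}_u(x)$ is undefined, set $u.\mathit{exit}=1$; then, if $u.S=\emptyset$ or $u.\mathit{exit}=1$, $\mathrm{Rej}(\{w\})$; else if $u.\mathit{vID}=x$, add $w$ to $u.\text{c-ids}$ and send IntroCert$(u)$ to $w$; else if $\mathrm{prop}_u$, forward the message to $\mathrm{NextStop}_u(x)$; else flush $\{w\}$. IntroCert$(w)$: add $w$ to $u.\text{c-ids}$. (c) *Tests.* Send TestLine-R$(u)$ to $u.S_r(1)$ and TestLine-L$(u)$ to $u.S_l(1)$ if these exist; for $1\le i\le\min(|u.L|,|u.R|)$ send FlyConst-R$(u.S_l(i),i,u)$ to $u.S_r(i)$ and FlyConst-L$(u.S_r(i),i,u)$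 to $u.S_l(i)$; if $\mathrm{prop}_u$, send TestFlyID$(u.\mathit{flyID})$ to all ids of other nodes in the memory (shortcuts, $\mathit{flyID}$, c-ids, memory and received messages of $\mathcal A_0$) except $u.\mathit{flyID}$; if $u.S=\emptyset$ and $u.\mathit{vID}=0$, send TestFlyID$(\bot)$ to all these ids; send TestvID$(u.\mathit{vID}\pm2^{i-1})$ to every $u.S_r(i)$, resp. $u.S_l(i)$; if $u.\mathit{vID}>1$ and $u.\mathit{flyID}\ne u$, send TestCert$(u,u.\text{c-par},u.\text{c-dist})$ to $\mathrm{NextStop}_u(u.\text{c-par})$. (d) *Advice handling.* Truncate $u.t$ to $[0,5]$ and decrement it if positive; if then $u.t\le1$ and ($u.S=\emptyset$ or $u.\mathit{exit}=1$), set $u.\mathit{vID}=0$. The following functions change variables only if $u.S=\emptyset$ and $u.\mathit{exit}=0$; all ids received in their messages are flushed or stored as shortcuts. If $u.t=0$ and a RequestSnapshot message is received, set $u.t=5$, send Intro$(u)$ to every id known to $\mathcal A_0$, Intro of each such id to $u$ itself, and the set of these ids to the supervisor. Call $u$ *handling* if $u.S=\emptyset$, $u.\mathit{exit}=0$ and $u.t>1$.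 If $u$ is handling, $u.t=4$ and an Advice message $(\mathit{par},\mathit{dist},\mathit{vID},\text{c-par},\text{c-dist})$ is received (the first one in the channel counts) that is well-formed (non-negative $\mathit{vID}$ and c-par; $\mathit{par}=\bot$, $\mathit{dist}=\text{c-dist}=0$, $\mathit{vID}=1$, or $\mathit{par}$ is an id received in an Intro message, $\mathit{dist},\text{c-dist}>0$, $\mathit{vID}>1$), copy its numbers to the variables and send TestAdvice$(u.\mathit{dist},u)$ to $\mathit{par}\neq\bot$. If $u$ is handling and receives TestAdvice$(d,v)$ messages, all with $d-1=u.\mathit{dist}$, with sorted senders $u_1<\dots<u_q$, then send Verified(parent, $u$) to all $u_j$, Verified(sib+, $u_{j+1}$) to $u_j$, Verified(sib$-$, $u_j$) to $u_{j+1}$, and Verified(child, $u_j$) to $u$ itself. If $u$ is handling, $u.\mathit{dist}\ge1$, and the received Verified messages contain one parent $p$, at most one sib+ $a$ and at most one sib$-$ $b$, and children $D$: if $u.\mathit{dist}$ is odd, let $x=\max D$ ($x=u$ if $D=\emptyset$) and $y=a$ ($y=p$ if there is no $a$), send Path+$(x)$ to $y$ and Path$-(y)$ to $x$; if even, let $x=\min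 D$ (or $u$), $y=b$ (or $p$), send Path$-(x)$ to $y$ and Path+$(y)$ to $x$. If $u$ is handling and receives at most one Path+ and at most one Path$-$ message, and no Path$-$ message if $u.\mathit{vID}=1$, then $u.L$ and $u.R$ become the lists with the id of the Path$-$, resp. Path+ message as only entry (empty if there is none). (e) Run $\mathcal A_0$, with $u.\text{c-ids}$ as additional input. The value of a variable *in round $\rho$* is its value after step (b), from which the tests of that round are sent; *$u.\mathit{exit}$ is $0$ in round $\rho$* means that it equals $1$ at no time during round $\rho$. **Definitions** (in a fixed round). A set $B\subseteq V$ with $|B|\ge2$ is a *backbone* if $B=\{v_1,\dots,v_{|B|}\}$ with $v_i.S_r(1)=v_{i+1}$ and $v_{i+1}.S_l(1)=v_i$ for $1\le i<|B|$, and ($v_1.L=\emptyset$ or $v_1.S_l(1)\notin B$) and ($v_{|B|}.R=\emptyset$ or $v_{|B|}.S_r(1)\notin B$). It is *maximal* if $B\cup\{u\}$ is not a backbone for any $u\in V\setminus B$, and *winged* if $v_1.L\ne\emptyset$ or $v_{|B|}.R\neq\emptyset$. A backbone is a *flyover* if $v_{i+1}.\mathit{vID}=v_i.\mathit{vID}+1$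 for $1\le i<|B|$, and $v_i.S_r(j)=v_{i+2^{j-1}}$, $v_{i+2^{j-1}}.S_l(j)=v_i$ for $1\le i<|B|$ and $1\le j\le\lfloor\log_2(|B|-i)\rfloor+1$. Let $G^*_B$ be the path on $B$ joining nodes with consecutive ids in $B$, and $T^*_B$ its spanning tree rooted at $v_1$. A maximal backbone $B$ is *correctly configured* if (1) $v_i.\mathit{vID}=i$ and $v_i.\mathit{flyID}=v_1$ for $1\le i\le|B|$; (2) for $2\le i\le|B|$, $v_i.\text{c-par}$ is the $\mathit{vID}$ of the parent of $v_i$ in $T^*_B$; (3) for all $i$, all neighbours of $v_i$ in $G^*_B$ are in $v_i.\text{c-ids}$; (4) for all $i$, $v_i.\text{c-dist}$ is the distance of $v_i$ and $v_1$ in $T^*_B$. **Lemma.** Let $B\subseteq V$ be a maximal backbone in a round $r>5$ that is not winged, and suppose that $u.\mathit{exit}$ is $0$ in all rounds $r,r+1,\dots,T$ for all $u\in B$. 1. If $T\ge r+2\lceil\log_2|B|\rceil$, then in every round $r'\in\{r+2\lceil\log_2|B|\rceil,\dots,T\}$, $B$ is a flyover, and there is $v\in B$ with $v.L=\emptyset$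 and $u.\mathit{flyID}=v$ for all $u\in B$. 2. If $T\ge r+3\lceil\log_2|B|\rceil$ and $u.S\subseteq B$ in round $r$ for all $u\in B$, then in every round $r'\in\{r+3\lceil\log_2|B|\rceil,\dots,T\}$, $B$ is correctly configured. -/

import Mathlib

namespace Overlay

/-! ### Variables, messages, base algorithm

Node ids are the elements of a finite linearly ordered type `V`; a node is identified with its id.
`M` is the type of memory states and `X` the type of messages of the base algorithm. -/

inductive Side
  | left
  | right

def Side.opp : Side → Side
  | .left => .right
  | .right => .left

/-- The variables of a node. `L` and `R` list the left and right shortcuts by level: the entry at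
(zero-based) position `i - 1` is the `i`-level shortcut. -/
structure Vars (V : Type*) where
  L : List V
  R : List V
  vID : ℤ
  flyID : V
  exit : Bool
  cpar : ℤ
  cdist : ℤ
  cids : Finset V
  t : ℤ
  dist : ℤ

/-- The content of an advice message; `par = none` stands for `⊥`. -/
structure Advice (V : Type*) where
  par : Option V
  dist : ℤ
  vID : ℤ
  cpar : ℤ
  cdist : ℤ

/-- The role in which an id is announced in a `Verified` message. -/
inductive Role
  | parent
  | sibPlus
  | sibMinus
  | child

/-- Messages. `testLine .right` and `flyConst .right` are the messages `TestLine-R` and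
`FlyConst-R` (sent to right shortcuts), similarly for `.left`; `path .right` is `Path+` and
`path .left` is `Path-`; `testFlyID none` carries `⊥`. -/
inductive Msg (V X : Type*)
  | rejFlyover
  | testLine (s : Side) (sen : V)
  | flyConst (s : Side) (w : V) (i : ℕ) (sen : V)
  | testVID (x : ℤ)
  | testFlyID (f : Option V)
  | testCert (w : V) (vid : ℤ) (d : ℤ)
  | introCert (w : V)
  | requestSnapshot
  | neighborhood (snap : Finset V)
  | advice (a : Advice V)
  | intro (v : V)
  | testAdvice (d : ℤ) (v : V)
  | verified (k : Role) (v : V)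
  | path (s : Side) (v : V)
  | base (x : X)

/-- The kinds of messages that the supervisor sends to nodes. -/
def Msg.IsFromSupervisor {V X : Type*} : Msg V X → Prop
  | .requestSnapshot => True
  | .advice _ => True
  | _ => False

/-- A base algorithm: an arbitrary local algorithm with its own memory and its own messages.
`memIds` and `msgIds` give the node ids stored in a memory state, resp. in a message; `flush`
stores a set of ids in the memory; `step u N m ch` is the round of node `u` with advised neighbours
`N`, memory `m` and received base messages `ch`. -/
structure BaseAlgorithm (V M X : Type*) [DecidableEq V] where
  memIds : M → Finset V
  msgIds : X → Finset V
  flush : M → Finset V → M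
  flush_ids : ∀ m s, memIds m ∪ s ⊆ memIds (flush m s)
  step : V → Finset V → M → List X → M × List (V × X)

/-- A configuration: variables, base memory and channel of every node. -/
structure Config (V M X : Type*) where
  vars : V → Vars V
  mem : V → M
  chan : V → List (Msg V X)

/-- The state of a node within a round: its variables, its base memory and the messages sent so far
in this round (`none` is the supervisor as recipient). -/
structure Work (V M X : Type*) where
  vars : Vars V
  mem : M
  out : List (Option V × Msg V X)

namespace Vars

variable {V : Type*}

/-- The list of left or right shortcuts. -/
def short (u : Vars V) : Side → List V
  | .left => u.L
  | .right => u.R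

/-- The `i`-level left or right shortcut `S_l(i)`, `S_r(i)`, for `i ≥ 1`. -/
def sc (u : Vars V) (s : Side) (i : ℕ) : Option V :=
  if i = 0 then none else (u.short s)[i - 1]?

/-- Append a shortcut on the next level. -/
def push (u : Vars V) (s : Side) (w : V) : Vars V :=
  match s with
  | .left => { u with L := u.L ++ [w] }
  | .right => { u with R := u.R ++ [w] }

/-- `u.S = ∅`. -/
def noS (u : Vars V) : Prop := u.L = [] ∧ u.R = []

instance [DecidableEq V] (u : Vars V) : Decidable u.noS := by
  unfold noS; infer_instance

/-- The set of all shortcuts. -/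
def S [DecidableEq V] (u : Vars V) : Finset V := u.L.toFinset ∪ u.R.toFinset

def setExit (u : Vars V) : Vars V := { u with exit := true }

/-- The level whose virtual id (that of `u` plus `sgn * 2 ^ (level - 1)`) is closest to `val`. -/
def closest (u : Vars V) (s : Side) (sgn : ℤ) (val : ℤ) : Option V :=
  (((List.range (u.short s).length).map (· + 1)).argmin
    fun i => (u.vID + sgn * 2 ^ (i - 1) - val).natAbs).bind (u.sc s)

/-- `NextStop`; `none` is the failure value. -/
def nextStop [DecidableEq V] (u : Vars V) (val : ℤ) : Option V :=
  if val < 1 ∨ val = u.vID then none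
  else if u.noS ∨ u.vID < 1 then none
  else if (val > u.vID ∧ u.R = []) ∨ (val < u.vID ∧ u.L = []) then none
  else if val > u.vID then u.closest .right 1 val
  else u.closest .left (-1) val

/-- The flag `prop-flyID` of node `u`. -/
def propFlyID (x : Vars V) (u : V) : Prop := x.vID = 1 ∨ (x.vID > 1 ∧ x.flyID ≠ u)

instance [DecidableEq V] (x : Vars V) (u : V) : Decidable (x.propFlyID u) := by
  unfold propFlyID; infer_instance

end Vars

section Algorithm

variable {V M X : Type*} [LinearOrder V] (A : BaseAlgorithm V M X)

namespace Work

def send (w : Work V M X) (dst : Option V) (m : Msg V X) : Work V M X :=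
  { w with out := w.out ++ [(dst, m)] }

/-- Send `m` to the given node, if there is one. -/
def sendOpt (w : Work V M X) (dst : Option V) (m : Msg V X) : Work V M X :=
  match dst with
  | none => w
  | some v => w.send (some v) m

def sendAll (w : Work V M X) (dst : Finset V) (m : Msg V X) : Work V M X :=
  { w with out := w.out ++ dst.sort.map fun v => (some v, m) }

def setExit (w : Work V M X) : Work V M X := { w with vars := w.vars.setExit }

end Work

/-- Store a set of ids in the memory of the base algorithm. -/
def flush (w : Work V M X) (s : Finset V) : Work V M X := { w with mem := A.flush w.mem s }

/-- `SendRejFly`. -/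
def sendRejFly (w : Work V M X) (s : Finset V) : Work V M X :=
  flush A (w.sendAll s .rejFlyover) s

/-! ### Init -/

/-- `BasicChecks` of node `u` with channel `ch`. -/
def basicChecks (u : V) (ch : List (Msg V X)) (x : Vars V) : Vars V :=
  if (∃ m ∈ ch, (match m with | .rejFlyover => true | _ => false) = true)
    ∨ (x.noS ∧ (x.cids ≠ ∅ ∨ x.flyID ≠ u))
    ∨ (x.L ≠ [] ∧ x.vID ≤ 1)
    ∨ ((x.L = [] ∧ x.R ≠ []) ∧ (x.vID ≠ 1 ∨ x.flyID ≠ u))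
    ∨ (x.vID = 1 ∧ x.cdist ≠ 0)
    ∨ (x.vID > 1 ∧ x.cdist ≤ 0)
    ∨ ((¬ x.noS ∧ x.vID > 1) ∧ x.nextStop x.cpar = none)
    ∨ x.cids.card > 2
    ∨ (x.cids.card = 2 ∧ ∀ y ∈ x.cids, y < u)
    ∨ (x.cids.card = 2 ∧ ∀ y ∈ x.cids, u < y)
  then x.setExit else x

/-- `RejectFlyover`. -/
def rejectFlyover (u : V) (w : Work V M X) : Work V M X :=
  if w.vars.exit then
    let w' := sendRejFly A w ((w.vars.S ∪ {w.vars.flyID} ∪ w.vars.cids).erase u)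
    { w' with vars := { w'.vars with
        L := [], R := [], vID := 0, flyID := u, exit := false, cpar := 0, cdist := -1, cids := ∅ } }
  else w

/-! ### Responses to received flyover messages -/

/-- `R_TestFlyoverConstruction`, messages `TestLine-R` and `TestLine-L`. -/
def onTestLine (w : Work V M X) : Msg V X → Work V M X
  | .testLine s sen =>
    let w := if w.vars.sc s.opp 1 ≠ some sen then w.setExit else w
    if w.vars.noS ∨ w.vars.exit then sendRejFly A w {sen} else w
  | _ => w

/-- `R_TestFlyoverConstruction`, messages `FlyConst-R` and `FlyConst-L`. -/
def onFlyConst (w : Work V M X) : Msg V X → Work V M X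
  | .flyConst s y i sen =>
    let side := s.opp
    let len := fun w : Work V M X => (w.vars.short side).length
    let w := if len w = 0 ∨ (len w ≥ i ∧ w.vars.sc side i ≠ some sen) then w.setExit else w
    let w := if len w ≥ i + 1 ∧ w.vars.sc side (i + 1) ≠ some y then w.setExit else w
    let w := if w.vars.exit = false ∧ (1 < len w ∧ len w < i) then flush A w {sen, y} else w
    let w := if w.vars.exit = false ∧ (len w = i ∧ w.vars.sc side i = some sen)
      then { w with vars := w.vars.push side y } else w
    if w.vars.noS ∨ w.vars.exit then sendRejFly A w {sen, y} else w
  | _ => w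

/-- `R_TestFlyoverMetadata`, messages `TestvID`. -/
def onTestVID (w : Work V M X) : Msg V X → Work V M X
  | .testVID x => if w.vars.noS ∨ w.vars.vID ≠ x then w.setExit else w
  | _ => w

/-- `R_TestFlyoverMetadata`, messages `TestFlyID`. -/
def onTestFlyID (u : V) (w : Work V M X) : Msg V X → Work V M X
  | .testFlyID f =>
    let w := if w.vars.L ≠ [] ∧ w.vars.exit = false ∧ w.vars.flyID = u
      then { w with vars := { w.vars with flyID := f.getD w.vars.flyID } } else w
    let w := if ¬ w.vars.noS ∧ some w.vars.flyID ≠ f then w.setExit else w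
    let w := if w.vars.noS ∧ f ≠ none then w.setExit else w
    if w.vars.exit then sendRejFly A w f.toFinset else w
  | _ => w

/-- `R_TestConnCert`, messages `TestCert`. -/
def onTestCert (u : V) (w : Work V M X) : Msg V X → Work V M X
  | .testCert y vid d =>
    let w := if w.vars.vID = vid ∧ d - 1 ≠ w.vars.cdist then w.setExit else w
    let w := if w.vars.vID ≠ vid ∧ w.vars.nextStop vid = none then w.setExit else w
    if w.vars.noS ∨ w.vars.exit then sendRejFly A w {y}
    else if w.vars.vID = vid then
      Work.send { w with vars := { w.vars with cids := insert y w.vars.cids } }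
        (some y) (.introCert u)
    else if w.vars.propFlyID u then w.sendOpt (w.vars.nextStop vid) (.testCert y vid d)
    else flush A w {y}
  | _ => w

/-- `R_TestConnCert`, messages `IntroCert`. -/
def onIntroCert (w : Work V M X) : Msg V X → Work V M X
  | .introCert y => { w with vars := { w.vars with cids := insert y w.vars.cids } }
  | _ => w

/-- All response functions; each loop runs over the received messages in channel order. -/
def responses (u : V) (ch : List (Msg V X)) (w : Work V M X) : Work V M X :=
  let w := ch.foldl (onTestLine A) w
  let w := ch.foldl (onFlyConst A) w
  let w := ch.foldl onTestVID w
  let w := ch.foldl (onTestFlyID A u) w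
  let w := ch.foldl (onTestCert A u) w
  ch.foldl onIntroCert w

/-! ### Test messages sent in every round -/

def baseMsgs (ch : List (Msg V X)) : List X :=
  ch.filterMap fun m => match m with | .base x => some x | _ => none

/-- The ids in the memory (including the received messages) of the base algorithm. -/
def baseIds (ch : List (Msg V X)) (w : Work V M X) : Finset V :=
  A.memIds w.mem ∪ ((baseMsgs ch).map A.msgIds).foldr (· ∪ ·) ∅

/-- The ids of other nodes in the memory of node `u`. -/
def allIds (u : V) (ch : List (Msg V X)) (w : Work V M X) : Finset V :=
  (w.vars.S ∪ {w.vars.flyID} ∪ w.vars.cids ∪ baseIds A ch w).erase u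

/-- `TestFlyoverConstruction`. -/
def testFlyoverConstruction (u : V) (w : Work V M X) : Work V M X :=
  let x := w.vars
  let w := w.sendOpt (x.sc .right 1) (.testLine .right u)
  let w := w.sendOpt (x.sc .left 1) (.testLine .left u)
  ((List.range (min x.R.length x.L.length)).map (· + 1)).foldl (fun w i =>
    match x.sc .left i, x.sc .right i with
    | some l, some r =>
      (w.send (some r) (.flyConst .right l i u)).send (some l) (.flyConst .left r i u)
    | _, _ => w) w

/-- `TestFlyoverMetadata`. -/
def testFlyoverMetadata (u : V) (ch : List (Msg V X)) (w : Work V M X) : Work V M X :=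
  let x := w.vars
  let w := if x.propFlyID u
    then w.sendAll ((allIds A u ch w).erase x.flyID) (.testFlyID (some x.flyID)) else w
  let w := if x.noS ∧ x.vID = 0 then w.sendAll (allIds A u ch w) (.testFlyID none) else w
  let w := ((List.range x.R.length).map (· + 1)).foldl (fun w i =>
    w.sendOpt (x.sc .right i) (.testVID (x.vID + 2 ^ (i - 1)))) w
  ((List.range x.L.length).map (· + 1)).foldl (fun w i =>
    w.sendOpt (x.sc .left i) (.testVID (x.vID - 2 ^ (i - 1)))) w

/-- `TestConnCert`. -/
def testConnCert (u : V) (w : Work V M X) : Work V M X :=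
  let x := w.vars
  if x.vID > 1 ∧ x.flyID ≠ u then w.sendOpt (x.nextStop x.cpar) (.testCert u x.cpar x.cdist) else w

def tests (u : V) (ch : List (Msg V X)) (w : Work V M X) : Work V M X :=
  testConnCert u (testFlyoverMetadata A u ch (testFlyoverConstruction u w))

/-! ### Interaction with the supervisor and distributed tree-to-path -/

/-- `BasicChecks2`. -/
def basicChecks2 (x : Vars V) : Vars V :=
  let x := if x.t > 5 then { x with t := 5 } else x
  let x := if x.t < 0 then { x with t := 0 } else x
  let x := if x.t > 0 then { x with t := x.t - 1 } else x
  if x.t ≤ 1 ∧ (x.noS ∨ x.exit) then { x with vID := 0 } else x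

/-- `SnapshotReq`. -/
def snapshotReq (u : V) (ch : List (Msg V X)) (w : Work V M X) : Work V M X :=
  if (w.vars.noS ∧ w.vars.exit = false ∧ w.vars.t = 0) ∧
      ∃ m ∈ ch, (match m with | .requestSnapshot => true | _ => false) = true then
    let snap := baseIds A ch w
    let w := { w with vars := { w.vars with t := 5 } }
    let w := w.sendAll snap (.intro u)
    let w := snap.sort.foldl (fun w v => w.send (some u) (.intro v)) w
    w.send none (.neighborhood snap)
  else w

/-- The node is not part of a flyover and its timer is running; otherwise the messages of the
advice-handling functions are ignored. -/
def handling (x : Vars V) : Bool := decide (x.noS ∧ x.exit = false ∧ x.t > 1)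

/-- Well-formed advice. -/
def Advice.WellFormed (a : Advice V) (snap : Finset V) : Prop :=
  (match a.par with
    | none => a.dist = 0 ∧ a.vID = 1 ∧ a.cdist = 0
    | some p => p ∈ snap ∧ a.dist > 0 ∧ a.vID > 1 ∧ a.cdist > 0) ∧ 0 ≤ a.vID ∧ 0 ≤ a.cpar

instance (a : Advice V) (snap : Finset V) : Decidable (a.WellFormed snap) := by
  unfold Advice.WellFormed; cases a.par <;> infer_instance

/-- `GetAdvice`. -/
def getAdvice (u : V) (ch : List (Msg V X)) (w : Work V M X) : Work V M X :=
  let snap : Finset V :=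
    (ch.filterMap fun m => match m with | .intro v => some v | _ => none).toFinset
  let adv := (ch.filterMap fun m => match m with | .advice a => some a | _ => none).head?
  let w := match adv with
    | none => w
    | some a =>
      if handling w.vars ∧ w.vars.t = 4 ∧ a.WellFormed snap then
        Work.sendOpt { w with vars := { w.vars with
            vID := a.vID, cpar := a.cpar, cdist := a.cdist, dist := a.dist } }
          a.par (.testAdvice a.dist u)
      else w
  flush A w snap

/-- `SetupLocalTransform`. -/
def setupLocalTransform (u : V) (children : Finset V) (w : Work V M X) : Work V M X :=
  let l := children.sort
  let w := w.sendAll children (.verified .parent u)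
  let w := (l.zip l.tail).foldl (fun w p =>
    (w.send (some p.1) (.verified .sibPlus p.2)).send (some p.2) (.verified .sibMinus p.1)) w
  l.foldl (fun w v => w.send (some u) (.verified .child v)) w

/-- `CertifyTree`. -/
def certifyTree (u : V) (ch : List (Msg V X)) (w : Work V M X) : Work V M X :=
  let recv := ch.filterMap fun m => match m with | .testAdvice d v => some (d, v) | _ => none
  let children : Finset V := (recv.map Prod.snd).toFinset
  let w := if handling w.vars ∧ (∀ p ∈ recv, w.vars.dist = p.1 - 1) ∧ children ≠ ∅
    then setupLocalTransform u children w else w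
  flush A w children

/-- `ExecuteTransform`. -/
def executeTransform (u parent : V) (rsib lsib : Option V) (children : Finset V)
    (w : Work V M X) : Work V M X :=
  if w.vars.dist ≠ 0 ∧ w.vars.dist % 2 = 1 then
    let x := children.sort.getLast?.getD u
    let y := rsib.getD parent
    (w.send (some y) (.path .right x)).send (some x) (.path .left y)
  else if w.vars.dist ≠ 0 ∧ w.vars.dist % 2 = 0 then
    let x := children.sort.head?.getD u
    let y := lsib.getD parent
    (w.send (some y) (.path .left x)).send (some x) (.path .right y)
  else w

/-- The local variables of `LocalTransform`. -/
structure Family (V : Type*) where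
  ignore : Bool
  parent : Option V
  rsib : Option V
  lsib : Option V
  children : Finset V

/-- One iteration of the loop of `LocalTransform`. -/
def Family.add (f : Family V) (k : Role) (v : V) : Family V :=
  match k with
  | .parent =>
    if f.ignore ∨ f.parent ≠ none then { f with ignore := true, children := insert v f.children }
    else { f with parent := some v }
  | .sibMinus =>
    if f.ignore ∨ f.lsib ≠ none then { f with ignore := true, children := insert v f.children }
    else { f with lsib := some v }
  | .sibPlus =>
    if f.ignore ∨ f.rsib ≠ none then { f with ignore := true, children := insert v f.children }
    else { f with rsib := some v }
  | .child => { f with children := insert v f.children }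

/-- `LocalTransform`. -/
def localTransform (u : V) (ch : List (Msg V X)) (w : Work V M X) : Work V M X :=
  let f : Family V := ch.foldl (fun f m => match m with | .verified k v => f.add k v | _ => f)
    ⟨!handling w.vars, none, none, none, ∅⟩
  let w := match f.parent with
    | none => w
    | some p =>
      if f.ignore = false ∧ ¬ w.vars.dist < 1
        then executeTransform u p f.rsib f.lsib f.children w else w
  flush A w (f.parent.toFinset ∪ f.rsib.toFinset ∪ f.lsib.toFinset ∪ f.children)

/-- The local variables of `JoinPath`, together with the ids flushed in its loop. -/
structure Join (V : Type*) where
  ignore : Bool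
  flyL : Option V
  flyR : Option V
  rest : Finset V

/-- One iteration of the loop of `JoinPath`. -/
def Join.add (x : Vars V) (j : Join V) (s : Side) (v : V) : Join V :=
  match s with
  | .left =>
    if j.ignore ∨ x.vID = 1 ∨ j.flyL ≠ none
    then { j with ignore := true, rest := insert v j.rest } else { j with flyL := some v }
  | .right =>
    if j.ignore ∨ j.flyR ≠ none
    then { j with ignore := true, rest := insert v j.rest } else { j with flyR := some v }

/-- `JoinPath`. -/
def joinPath (ch : List (Msg V X)) (w : Work V M X) : Work V M X :=
  let j : Join V := ch.foldl (fun j m => match m with | .path s v => j.add w.vars s v | _ => j)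
    ⟨!handling w.vars, none, none, ∅⟩
  let w := if j.ignore = false
    then { w with vars := { w.vars with L := j.flyL.toList, R := j.flyR.toList } } else w
  flush A w (j.rest ∪ j.flyL.toFinset ∪ j.flyR.toFinset)

def adviceHandling (u : V) (ch : List (Msg V X)) (w : Work V M X) : Work V M X :=
  let w := { w with vars := basicChecks2 w.vars }
  joinPath A ch (localTransform A u ch (certifyTree A u ch (getAdvice A u ch
    (snapshotReq A u ch w))))

/-- The base algorithm, run with the ids in `c-ids` as advised neighbours. -/
def runBase (u : V) (ch : List (Msg V X)) (w : Work V M X) : Work V M X :=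
  let q := A.step u w.vars.cids w.mem (baseMsgs ch)
  { w with mem := q.1, out := w.out ++ q.2.map fun p => (some p.1, .base p.2) }

/-! ### Rounds and executions

In a round a node first runs the checks, then reads its channel, then sends its test messages, then
runs the advice-handling functions and the base algorithm. -/

/-- The variables of node `u` after `BasicChecks`. -/
def afterChecks (c : Config V M X) (u : V) : Vars V := basicChecks u (c.chan u) (c.vars u)

/-- The state of node `u` after it has processed the flyover messages in its channel. -/
def afterResponses (c : Config V M X) (u : V) : Work V M X :=
  responses A u (c.chan u) (rejectFlyover A u ⟨afterChecks c u, c.mem u, []⟩)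

/-- The state of node `u` at the end of the round. -/
def endOfRound (c : Config V M X) (u : V) : Work V M X :=
  runBase A u (c.chan u) (adviceHandling A u (c.chan u) (tests A u (c.chan u)
    (afterResponses A c u)))

/-- The messages sent by `w` to `u` in the round. -/
def sentTo (c : Config V M X) (w u : V) : List (Msg V X) :=
  (endOfRound A c w).out.filterMap fun p => if p.1 = some u then some p.2 else none

/-- One synchronous round leads from `c` to `c'`: all nodes execute their code, and every channel
then holds the messages sent to the node in this round together with arbitrary messages of the
supervisor, in an arbitrary order. -/
def Step [Fintype V] (c c' : Config V M X) : Prop :=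
  ∀ u, c'.vars u = (endOfRound A c u).vars ∧ c'.mem u = (endOfRound A c u).mem ∧
    ∃ sup : Multiset (Msg V X), (∀ m ∈ sup, m.IsFromSupervisor) ∧
      (c'.chan u : Multiset (Msg V X)) = sup + ∑ w, (sentTo A c w u : Multiset (Msg V X))

/-- `C ρ` is the configuration at the start of round `ρ`; the configuration at the start of round
`1` is arbitrary. -/
def IsExecution [Fintype V] (C : ℕ → Config V M X) : Prop :=
  ∀ ρ, 1 ≤ ρ → Step A (C ρ) (C (ρ + 1))

/-- The variables of the nodes in the round that starts in configuration `c`: their values after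
the channels have been read, from which the test messages of the round are sent. -/
def inRound (c : Config V M X) : V → Vars V := fun u => (afterResponses A c u).vars

/-- In the round that starts in `c`, the `exit` variable of `u` is never `1`. (Only the basic checks
and the responses assign `1` to `exit`; only `RejectFlyover`, between them, assigns `0`.) -/
def KeepsExitZero (c : Config V M X) (u : V) : Prop :=
  (afterChecks c u).exit = false ∧ (afterResponses A c u).vars.exit = false

end Algorithm

/-! ### Backbones, flyovers, correct configuration -/

section Structure

variable {V : Type*} [LinearOrder V]

/-- `v 1, …, v |B|` enumerates `B` as a backbone, given the variables `s` of all nodes. -/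
structure IsSpineOf (s : V → Vars V) (B : Finset V) (v : ℕ → V) : Prop where
  two_le : 2 ≤ B.card
  bij : Set.BijOn v (Set.Icc 1 B.card) B
  left_wing : (s (v 1)).L = [] ∨ ∃ x, (s (v 1)).sc .left 1 = some x ∧ x ∉ B
  right_wing : (s (v B.card)).R = [] ∨ ∃ x, (s (v B.card)).sc .right 1 = some x ∧ x ∉ B
  spine : ∀ i, 1 ≤ i → i ≤ B.card - 1 →
    (s (v i)).sc .right 1 = some (v (i + 1)) ∧ (s (v (i + 1))).sc .left 1 = some (v i)

def IsBackbone (s : V → Vars V) (B : Finset V) : Prop := ∃ v, IsSpineOf s B v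

def IsMaximalBackbone (s : V → Vars V) (B : Finset V) : Prop :=
  IsBackbone s B ∧ ∀ u, u ∉ B → ¬ IsBackbone s (insert u B)

def IsWinged (s : V → Vars V) (B : Finset V) : Prop :=
  ∃ v, IsSpineOf s B v ∧ ((s (v 1)).L ≠ [] ∨ (s (v B.card)).R ≠ [])

/-- A backbone with consecutive virtual ids and all shortcuts at distances `1, 2, 4, …` within it. -/
def IsFlyover (s : V → Vars V) (B : Finset V) : Prop :=
  ∃ v, IsSpineOf s B v ∧
    (∀ i, 1 ≤ i → i ≤ B.card - 1 → (s (v (i + 1))).vID = (s (v i)).vID + 1) ∧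
    ∀ i, 1 ≤ i → i ≤ B.card - 1 → ∀ j, 1 ≤ j → j ≤ Nat.log 2 (B.card - i) + 1 →
      (s (v i)).sc .right j = some (v (i + 2 ^ (j - 1))) ∧
      (s (v (i + 2 ^ (j - 1)))).sc .left j = some (v i)

/-- `b` is the successor of `a` in `B`. -/
def IsSuccIn (B : Finset V) (a b : V) : Prop := b ∈ B ∧ a < b ∧ ∀ w ∈ B, a < w → b ≤ w

/-- The sorted path over `B`. -/
def sortedPath (B : Finset V) : SimpleGraph B where
  Adj a b := IsSuccIn B a b ∨ IsSuccIn B b a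
  symm := ⟨fun _ _ h => h.symm⟩
  loopless := ⟨fun _ h => h.elim (fun h => lt_irrefl _ h.2.1) (fun h => lt_irrefl _ h.2.1)⟩

/-- `p` is the parent of `a` in the tree `T` rooted at `root`. -/
def IsParent {W : Type*} (T : SimpleGraph W) (root a p : W) : Prop :=
  T.Adj a p ∧ T.dist a root = T.dist p root + 1

/-- Correctly configured maximal backbone. The tree `T` is the spanning tree of the sorted path
over `B`, rooted at `v 1`. -/
def IsCorrectlyConfigured (s : V → Vars V) (B : Finset V) : Prop :=
  IsMaximalBackbone s B ∧ ∃ v, IsSpineOf s B v ∧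
    (∀ i, 1 ≤ i → i ≤ B.card → (s (v i)).vID = i ∧ (s (v i)).flyID = v 1) ∧
    (∀ a b : B, (sortedPath B).Adj a b → (b : V) ∈ (s a).cids) ∧
    ∃ (T : SimpleGraph B) (root : B), T ≤ sortedPath B ∧ T.IsTree ∧ (root : V) = v 1 ∧
      (∀ a : B, a ≠ root → ∃ p : B, IsParent T root a p ∧ (s a).cpar = (s p).vID) ∧
      ∀ a : B, (s a).cdist = T.dist a root

end Structure

end Overlay

/-! Write `k` for `Nat.clog 2 B.card`. As long as a node of `B` keeps `exit` at `0`, its variables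
are rigid (`VarsEvolve`, `IsStableRun.step`): shortcut lists only grow at the end, an empty list
stays empty, virtual id, c-par and c-dist are frozen, c-ids only grows, and a flyover id can only be
replaced while it is the node's own id. Facts, once established, therefore persist, and every
received test becomes an equation, because a violation would set `exit` (`recv_flyConst`,
`recv_testVID`, `recv_testFlyID`).

Shape of the flyover. Having no left shortcut, `v 1` is forced by its checks to have virtual id 1
and its own id as flyover id, and the virtual-id tests along the spine number the other nodes
(`vID_eq`). A node that knows its neighbours at distance `2 ^ j` on both sides introduces them to
each other, so one more level of shortcuts is complete in each round (`shortcuts`). Over these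
shortcuts the flyover id of `v 1` reaches twice as many nodes per round (`flyID_eq_of_le`). Both
processes are finished in round `r + k`.

Certificates. If the shortcuts of round `r` stay in `B`, so do all later ones (`sc_mem`), and the
virtual-id tests fix where each of them leads (`sc_eq`). Greedy routing then halves the distance per
hop (`nextStop_halves`). A certificate sent in round `r + k` thus reaches a node with virtual id
c-par within `k` hops; a c-par beyond `B.card` would strand it at the right end and set `exit`
there. Sender and recipient have each other in c-ids by round `r + 2 * k + 1`, and the sender's
c-dist exceeds the recipient's by one (`exists_parent`).

The order. By the c-dist relation, these parents form a tree rooted at `v 1`. The checks on c-ids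
allow a node only two tree neighbours, one smaller and one larger than itself. A finite rooted tree
with this property is the sorted path (`SortedTree.adj_iff`), and c-dist is the distance to its root
(`dist_root_eq_depth`). -/

namespace Overlay

set_option linter.unusedSectionVars false

/-! ### One round of a node: what the message handlers can change -/

section NodeRound

variable {V M X : Type*} [LinearOrder V] (A : BaseAlgorithm V M X)

def Msg.IsFlyConst : Msg V X → Prop
  | .flyConst .. => True
  | _ => False

/-- From `w` to `w'` messages other than `FlyConst` have been sent. -/
def Work.Ext (w w' : Work V M X) : Prop :=
  ∃ e, w'.out = w.out ++ e ∧ ∀ p ∈ e, ¬ p.2.IsFlyConst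

namespace Work.Ext

theorem of_out_eq {w w' : Work V M X} (h : w'.out = w.out) : w.Ext w' := ⟨[], by simp [h], by simp⟩

theorem refl (w : Work V M X) : w.Ext w := of_out_eq rfl

theorem trans {w w' w'' : Work V M X} (h : w.Ext w') (h' : w'.Ext w'') : w.Ext w'' := by
  obtain ⟨e, he, hp⟩ := h
  obtain ⟨e', he', hp'⟩ := h'
  refine ⟨e ++ e', by simp [he, he'], fun p h => ?_⟩
  rcases List.mem_append.1 h with h | h
  exacts [hp p h, hp' p h]

theorem mem {w w' : Work V M X} (h : w.Ext w') {p} (hp : p ∈ w.out) : p ∈ w'.out := by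
  obtain ⟨e, he, -⟩ := h
  simp [he, hp]

theorem mem_of_isFlyConst {w w' : Work V M X} (h : w.Ext w') {p} (hp : p ∈ w'.out)
    (hf : p.2.IsFlyConst) : p ∈ w.out := by
  obtain ⟨e, he, hn⟩ := h
  rw [he] at hp
  rcases List.mem_append.1 hp with h | h
  exacts [h, (hn p h hf).elim]

theorem send (w : Work V M X) (d : Option V) {m : Msg V X} (h : ¬ m.IsFlyConst) :
    w.Ext (w.send d m) := ⟨[(d, m)], rfl, by simpa using h⟩

theorem sendOpt (w : Work V M X) (d : Option V) {m : Msg V X} (h : ¬ m.IsFlyConst) :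
    w.Ext (w.sendOpt d m) := by
  cases d
  exacts [refl w, send w _ h]

theorem sendAll (w : Work V M X) (s : Finset V) {m : Msg V X} (h : ¬ m.IsFlyConst) :
    w.Ext (w.sendAll s m) := ⟨_, rfl, by simpa using fun _ _ => h⟩

theorem sendRejFly (w : Work V M X) (s : Finset V) : w.Ext (Overlay.sendRejFly A w s) :=
  sendAll w s (m := .rejFlyover) id

theorem foldl {N : Type*} (f : Work V M X → N → Work V M X) (hf : ∀ (w : Work V M X) n, w.Ext (f w n))
    (l : List N) (w : Work V M X) : w.Ext (l.foldl f w) := by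
  induction l generalizing w with
  | nil => exact refl w
  | cons a l ih => exact (hf w a).trans (ih _)

theorem ite {w a b : Work V M X} {p : Prop} [Decidable p] (ha : w.Ext a) (hb : w.Ext b) :
    w.Ext (if p then a else b) := by
  split_ifs
  exacts [ha, hb]

end Work.Ext

@[simp] theorem sendRejFly_vars (w : Work V M X) (s : Finset V) :
    (sendRejFly A w s).vars = w.vars := rfl

@[simp] theorem flush_vars (w : Work V M X) (s : Finset V) : (flush A w s).vars = w.vars := rfl

@[simp] theorem Work.setExit_exit (w : Work V M X) : w.setExit.vars.exit = true := rfl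

@[simp] theorem Work.sendOpt_vars (w : Work V M X) (d : Option V) (m : Msg V X) :
    (w.sendOpt d m).vars = w.vars := by cases d <;> rfl

@[simp] theorem Work.send_vars (w : Work V M X) (d : Option V) (m : Msg V X) :
    (w.send d m).vars = w.vars := rfl

@[simp] theorem Side.opp_opp (s : Side) : s.opp.opp = s := by cases s <;> rfl

theorem Vars.sc_prefix {x x' : Vars V} {s : Side} (h : x.short s <+: x'.short s) {i : ℕ} {z : V}
    (hz : x.sc s i = some z) : x'.sc s i = some z := by
  unfold Vars.sc at *
  split_ifs at * with h0
  obtain ⟨e, he⟩ := h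
  rw [← he, List.getElem?_append_left]
  · exact hz
  · by_contra hc
    rw [List.getElem?_eq_none (not_lt.1 hc)] at hz
    simp at hz

theorem Vars.short_push (x : Vars V) (s : Side) (w : V) :
    (x.push s w).short s = x.short s ++ [w] ∧ (x.push s w).short s.opp = x.short s.opp := by
  cases s <;> exact ⟨rfl, rfl⟩

/-- The changes of the variables of node `u` that are possible while `exit` stays `0`;
`ch` lists the received messages. -/
structure VarsEvolve (u : V) (ch : List (Msg V X)) (x x' : Vars V) : Prop where
  short : ∀ s, x.short s <+: x'.short s
  nil : ∀ s, x.short s = [] → x'.short s = []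
  vID : x'.vID = x.vID
  cpar : x'.cpar = x.cpar
  cdist : x'.cdist = x.cdist
  cids : x.cids ⊆ x'.cids
  fly : x'.flyID = x.flyID ∨ (x.flyID = u ∧ x.L ≠ [])
  origin : ∀ s l z, x'.sc s (l + 1) = some z → x.sc s (l + 1) = some z ∨
    ∃ sen, Msg.flyConst s.opp z l sen ∈ ch ∧ x'.sc s l = some sen

namespace VarsEvolve

theorem refl (u : V) (ch : List (Msg V X)) (x : Vars V) : VarsEvolve u ch x x where
  short _ := List.prefix_rfl
  nil _ := id
  vID := rfl
  cpar := rfl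
  cdist := rfl
  cids := Finset.Subset.refl _
  fly := Or.inl rfl
  origin _ _ _ := Or.inl

theorem trans {u : V} {ch : List (Msg V X)} {x x' x'' : Vars V} (h : VarsEvolve u ch x x')
    (h' : VarsEvolve u ch x' x'') : VarsEvolve u ch x x'' where
  short s := (h.short s).trans (h'.short s)
  nil s hs := h'.nil s (h.nil s hs)
  vID := h'.vID.trans h.vID
  cpar := h'.cpar.trans h.cpar
  cdist := h'.cdist.trans h.cdist
  cids := h.cids.trans h'.cids
  fly := by
    rcases h'.fly with h1 | ⟨h1, h2⟩
    · rw [h1]; exact h.fly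
    · rcases h.fly with h3 | h3
      · exact Or.inr ⟨h3 ▸ h1, fun h4 => h2 (h.nil .left h4)⟩
      · exact Or.inr h3
  origin s l z hz := by
    rcases h'.origin s l z hz with h1 | h1
    · rcases h.origin s l z h1 with h2 | ⟨sen, h2, h3⟩
      · exact Or.inl h2
      · exact Or.inr ⟨sen, h2, Vars.sc_prefix (h'.short s) h3⟩
    · exact Or.inr h1

end VarsEvolve

/-- The changes of the state of node `u` while `exit` stays `0`. -/
def Evolves (u : V) (ch : List (Msg V X)) (w w' : Work V M X) : Prop :=
  VarsEvolve u ch w.vars w'.vars ∧ w.Ext w'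

theorem Evolves.refl (u : V) (ch : List (Msg V X)) (w : Work V M X) : Evolves u ch w w :=
  ⟨.refl .., .refl _⟩

theorem Evolves.trans {u : V} {ch : List (Msg V X)} {w w' w'' : Work V M X}
    (h : Evolves u ch w w') (h' : Evolves u ch w' w'') : Evolves u ch w w'' :=
  ⟨h.1.trans h'.1, h.2.trans h'.2⟩

/-- Only `c-ids` grows, and messages are sent. -/
def CidsEvolve (w w' : Work V M X) : Prop :=
  (∃ s, w.vars.cids ⊆ s ∧ w'.vars = { w.vars with cids := s }) ∧ w.Ext w'

theorem CidsEvolve.refl (w : Work V M X) : CidsEvolve w w :=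
  ⟨⟨w.vars.cids, Finset.Subset.refl _, rfl⟩, .refl _⟩

theorem CidsEvolve.trans {w w' w'' : Work V M X} (h : CidsEvolve w w') (h' : CidsEvolve w' w'') :
    CidsEvolve w w'' := by
  obtain ⟨⟨s, hs, h1⟩, h2⟩ := h
  obtain ⟨⟨s', hs', h1'⟩, h2'⟩ := h'
  rw [h1] at hs' h1'
  exact ⟨⟨s', hs.trans hs', h1'⟩, h2.trans h2'⟩

theorem CidsEvolve.evolves {w w' : Work V M X} (h : CidsEvolve w w') (u : V)
    (ch : List (Msg V X)) : Evolves u ch w w' := by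
  obtain ⟨⟨s, hs, h1⟩, h2⟩ := h
  refine ⟨?_, h2⟩
  rw [h1]
  exact ⟨fun s => by cases s <;> exact List.prefix_rfl, fun s => by cases s <;> exact id, rfl, rfl,
    rfl, hs, Or.inl rfl, fun s _ _ => by cases s <;> exact Or.inl⟩

/-- A fold whose steps respect a preorder `R` as long as `G` holds at their ends. -/
theorem foldl_spec {W N : Type*} {f : W → N → W} {G : W → Prop} {R : W → W → Prop}
    (hrefl : ∀ w, R w w) (htrans : ∀ w w' w'', R w w' → R w' w'' → R w w'') (l : List N)
    (hG : ∀ w, ∀ m ∈ l, G (f w m) → G w) (hR : ∀ w, ∀ m ∈ l, G (f w m) → R w (f w m)) (w : W)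
    (h : G (l.foldl f w)) :
    G w ∧ R w (l.foldl f w) ∧
      ∀ m ∈ l, ∃ w', G (f w' m) ∧ R w w' ∧ R (f w' m) (l.foldl f w) := by
  induction l generalizing w with
  | nil => exact ⟨h, hrefl _, by simp⟩
  | cons a l ih =>
    obtain ⟨h1, h2, h3⟩ := ih (fun w m hm => hG w m (List.mem_cons_of_mem _ hm))
      (fun w m hm => hR w m (List.mem_cons_of_mem _ hm)) (f w a) h
    have ha := hR w a List.mem_cons_self h1
    refine ⟨hG w a List.mem_cons_self h1, htrans _ _ _ ha h2, fun m hm => ?_⟩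
    rcases List.mem_cons.1 hm with rfl | hm
    · exact ⟨w, h1, hrefl _, h2⟩
    · obtain ⟨w', h4, h5, h6⟩ := h3 m hm
      exact ⟨w', h4, htrans _ _ _ ha h5, h6⟩

/-! ### The handlers -/

theorem evolves_of_vars_eq {u : V} {ch : List (Msg V X)} {w w' : Work V M X}
    (h : w'.vars = w.vars) (h' : w.Ext w') : Evolves u ch w w' := ⟨h ▸ .refl .., h'⟩

theorem onTestLine_ext (w : Work V M X) (m : Msg V X) : w.Ext (onTestLine A w m) := by
  unfold onTestLine
  split
  · rename_i s sen
    refine Work.Ext.trans (w' := if w.vars.sc s.opp 1 ≠ some sen then w.setExit else w) ?_ ?_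
    · split <;> exact .of_out_eq rfl
    · dsimp only
      generalize (if w.vars.sc s.opp 1 ≠ some sen then w.setExit else w) = w'
      split
      exacts [.sendRejFly A _ _, .refl _]
  · exact .refl _

theorem onTestLine_vars {w : Work V M X} {m : Msg V X} (h : (onTestLine A w m).vars.exit = false) :
    (onTestLine A w m).vars = w.vars := by
  unfold onTestLine at *
  split at *
  · dsimp only at *
    by_cases h1 : w.vars.sc (Side.opp ‹_›) 1 ≠ some ‹_›
    · simp only [if_pos h1] at h
      split at h <;> simp at h
    · simp only [if_neg h1] at h ⊢
      split <;> rfl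
  · rfl

theorem onTestVID_ext (w : Work V M X) (m : Msg V X) : w.Ext (onTestVID w m) := by
  unfold onTestVID
  split
  · split <;> exact .of_out_eq rfl
  · exact .refl _

theorem onTestVID_vars {w : Work V M X} {m : Msg V X} (h : (onTestVID w m).vars.exit = false) :
    (onTestVID w m).vars = w.vars ∧ ∀ x, m = .testVID x → w.vars.vID = x := by
  unfold onTestVID at *
  split at *
  · split_ifs at * with h1
    · simp at h
    · exact ⟨rfl, fun x hx => by cases hx; tauto⟩
  · rename_i h1
    exact ⟨rfl, fun x hx => (h1 _ hx).elim⟩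

/-- The handler either adopts the received flyover id or compares with it, so for a node with
shortcuts both branches end in equality unless `exit` is set. -/
theorem onTestFlyID_spec {u : V} {w : Work V M X} {m : Msg V X}
    (h : (onTestFlyID A u w m).vars.exit = false) (ch : List (Msg V X)) :
    w.vars.exit = false ∧ Evolves u ch w (onTestFlyID A u w m) ∧
      ∀ f, m = .testFlyID (some f) → ¬ w.vars.noS → (onTestFlyID A u w m).vars.flyID = f := by
  unfold onTestFlyID at *
  split at *
  · rename_i f
    dsimp only at h ⊢
    set w1 : Work V M X := if w.vars.L ≠ [] ∧ w.vars.exit = false ∧ w.vars.flyID = u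
      then { w with vars := { w.vars with flyID := f.getD w.vars.flyID } } else w with hw1
    have e1 : w1.vars.exit = w.vars.exit ∧ Evolves u ch w w1 ∧
        (w1.vars.noS ↔ w.vars.noS) := by
      rw [hw1]
      split_ifs with h1
      · refine ⟨rfl, ⟨⟨fun s => by cases s <;> exact List.prefix_rfl,
          fun s => by cases s <;> exact id, rfl, rfl,
          rfl, Finset.Subset.refl _, Or.inr ⟨h1.2.2, h1.1⟩,
          fun s _ _ => by cases s <;> exact Or.inl⟩, .of_out_eq rfl⟩, Iff.rfl⟩
      · exact ⟨rfl, .refl .., Iff.rfl⟩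
    by_cases h2 : ¬ w1.vars.noS ∧ some w1.vars.flyID ≠ f
    · simp only [if_pos h2] at h
      split_ifs at h <;> simp_all
    simp only [if_neg h2] at h ⊢
    by_cases h3 : w1.vars.noS ∧ f ≠ none
    · simp only [if_pos h3] at h
      simp at h
    simp only [if_neg h3] at h ⊢
    have h4 : w1.vars.exit = false := by
      split_ifs at h
      · simpa using h
      · exact h
    simp only [h4, Bool.false_eq_true, if_false]
    refine ⟨e1.1 ▸ h4, e1.2.1, fun g hg hn => ?_⟩
    cases hg
    by_contra h5
    exact h2 ⟨fun h => hn (e1.2.2.1 h), by simpa using h5⟩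
  · rename_i h1
    exact ⟨h, .refl .., fun f hf => (h1 _ hf).elim⟩

theorem onTestCert_spec {u : V} {w : Work V M X} {m : Msg V X}
    (h : (onTestCert A u w m).vars.exit = false) :
    w.vars.exit = false ∧ CidsEvolve w (onTestCert A u w m) ∧
      ∀ y vid d, m = .testCert y vid d → ¬ w.vars.noS →
        (w.vars.vID = vid → d - 1 = w.vars.cdist ∧ y ∈ (onTestCert A u w m).vars.cids ∧
          (some y, .introCert u) ∈ (onTestCert A u w m).out) ∧
        (w.vars.vID ≠ vid → ∃ z, w.vars.nextStop vid = some z ∧ (w.vars.propFlyID u →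
          (some z, .testCert y vid d) ∈ (onTestCert A u w m).out)) := by
  unfold onTestCert at *
  split at *
  · rename_i y vid d
    dsimp only at h ⊢
    by_cases h1 : w.vars.vID = vid ∧ d - 1 ≠ w.vars.cdist
    · simp only [if_pos h1] at h
      split_ifs at h <;> simp_all [Work.setExit, Vars.setExit]
    simp only [if_neg h1] at h ⊢
    by_cases h2 : w.vars.vID ≠ vid ∧ w.vars.nextStop vid = none
    · simp only [if_pos h2] at h
      simp at h
    simp only [if_neg h2] at h ⊢
    have h3 : w.vars.exit = false := by
      split_ifs at h <;> simpa using h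
    refine ⟨h3, ?_, ?_⟩
    · split_ifs
      · exact ⟨⟨_, Finset.Subset.refl _, rfl⟩, .sendRejFly A _ _⟩
      · exact ⟨⟨_, Finset.subset_insert _ _, rfl⟩, .send _ _ (m := .introCert u) id⟩
      · exact ⟨⟨_, Finset.Subset.refl _, by simp⟩, .sendOpt _ _ (m := .testCert y vid d) id⟩
      · exact ⟨⟨_, Finset.Subset.refl _, rfl⟩, .of_out_eq rfl⟩
    · intro y' vid' d' he hn
      cases he
      have h4 : ¬ (w.vars.noS ∨ w.vars.exit = true) := by simp [hn, h3]
      simp only [if_neg h4]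
      constructor
      · intro h5
        simp only [if_pos h5]
        exact ⟨by tauto, by simp, by simp [Work.send]⟩
      · intro h5
        simp only [if_neg h5]
        obtain ⟨z, hz⟩ := Option.ne_none_iff_exists'.1 fun h => h2 ⟨h5, h⟩
        refine ⟨z, hz, fun hp => ?_⟩
        simp only [if_pos hp, hz, Work.sendOpt, Work.send]
        simp
  · rename_i h1
    exact ⟨h, .refl _, fun _ _ _ hf => (h1 _ _ _ hf).elim⟩

theorem onIntroCert_spec (w : Work V M X) (m : Msg V X) :
    (onIntroCert w m).vars.exit = w.vars.exit ∧ CidsEvolve w (onIntroCert w m) ∧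
      ∀ y, m = .introCert y → y ∈ (onIntroCert w m).vars.cids := by
  unfold onIntroCert
  split
  · exact ⟨rfl, ⟨⟨_, Finset.subset_insert _ _, rfl⟩, .of_out_eq rfl⟩,
      fun y hy => by cases hy; simp⟩
  · rename_i h1
    exact ⟨rfl, .refl _, fun _ hf => (h1 _ hf).elim⟩

/-- An empty list on the addressed side sets `exit`, which is why empty sides stay empty. If level
`i` is present, then level `i + 1` is either present, and must agree with `y`, or is the next free
position and is filled with `y`. -/
theorem onFlyConst_spec {u : V} {w : Work V M X} {m : Msg V X}
    (h : (onFlyConst A w m).vars.exit = false) (ch : List (Msg V X)) (hm : m ∈ ch) :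
    w.vars.exit = false ∧ Evolves u ch w (onFlyConst A w m) ∧
      ∀ s y i sen, m = .flyConst s y i sen → i ≤ (w.vars.short s.opp).length → 1 ≤ i →
        (onFlyConst A w m).vars.sc s.opp (i + 1) = some y := by
  unfold onFlyConst at *
  split at *
  · rename_i s y i sen
    dsimp only at h ⊢
    by_cases h1 : (w.vars.short s.opp).length = 0 ∨
        ((w.vars.short s.opp).length ≥ i ∧ w.vars.sc s.opp i ≠ some sen)
    · simp only [if_pos h1] at h
      split_ifs at h <;> simp_all
    simp only [if_neg h1] at h ⊢
    by_cases h2 : (w.vars.short s.opp).length ≥ i + 1 ∧ w.vars.sc s.opp (i + 1) ≠ some y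
    · simp only [if_pos h2] at h
      split_ifs at h <;> simp_all
    simp only [if_neg h2] at h ⊢
    set w1 : Work V M X := if w.vars.exit = false ∧ (1 < (w.vars.short s.opp).length ∧
      (w.vars.short s.opp).length < i) then flush A w {sen, y} else w with hw1
    have e1 : w1.vars = w.vars ∧ w1.out = w.out := by
      rw [hw1]; split_ifs <;> exact ⟨rfl, rfl⟩
    rw [e1.1] at h ⊢
    set w2 : Work V M X := if w.vars.exit = false ∧ ((w.vars.short s.opp).length = i ∧
      w.vars.sc s.opp i = some sen) then { w1 with vars := w.vars.push s.opp y } else w1 with hw2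
    have h3 : w2.vars.exit = false := by
      split_ifs at h <;> simpa using h
    have e2 : w.vars.exit = false := by
      rw [hw2] at h3
      split_ifs at h3 with h4
      · exact h4.1
      · rwa [e1.1] at h3
    have e3 : w2.out = w.out := by
      rw [hw2, ← e1.2]; split_ifs <;> rfl
    set w3 : Work V M X := if w2.vars.noS ∨ w2.vars.exit = true then sendRejFly A w2 {sen, y}
      else w2 with hw3
    have e4 : w3.vars = w2.vars ∧ w2.Ext w3 := by
      rw [hw3]; split_ifs
      exacts [⟨rfl, .sendRejFly A _ _⟩, ⟨rfl, .refl _⟩]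
    refine ⟨e2, ⟨?_, (Work.Ext.of_out_eq e3).trans e4.2⟩, ?_⟩
    · rw [e4.1, hw2]
      split_ifs with h4
      · have hne : w.vars.short s.opp ≠ [] := fun h => h1 (Or.inl (by simp [h]))
        have hsp := w.vars.short_push s.opp y
        have hp : ∀ s', w.vars.short s' <+: (w.vars.push s.opp y).short s' := by
          intro s'
          cases s <;> cases s' <;> simp [Side.opp, Vars.push, Vars.short]
        refine ⟨hp, ?_, ?_, ?_, ?_, ?_, Or.inl ?_, ?_⟩
        · intro s' hs'
          cases s <;> cases s' <;> first | exact (hne hs').elim | exact hs'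
        · cases s <;> rfl
        · cases s <;> rfl
        · cases s <;> rfl
        · cases s <;> exact Finset.Subset.refl _
        · cases s <;> rfl
        -- Only the last position of the extended list is new; the length condition makes it level
        -- `i + 1`, and level `i` holds the sender.
        · intro s' l z hz
          have key : s' = s.opp ∨ s' = s := by cases s <;> cases s' <;> simp [Side.opp]
          rcases key with rfl | rfl
          · by_cases hl : l < (w.vars.short s.opp).length
            · simp only [Vars.sc, hsp.1, Nat.add_one_ne_zero, if_false, Nat.add_sub_cancel,
                List.getElem?_append_left hl] at hz ⊢
              exact Or.inl hz
            · simp only [Vars.sc, hsp.1, Nat.add_one_ne_zero, if_false, Nat.add_sub_cancel,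
                List.getElem?_append_right (not_lt.1 hl)] at hz
              obtain ⟨h6, h7⟩ := List.getElem?_eq_some_iff.1 hz
              obtain rfl : l = i := by simp at h6; omega
              obtain rfl : y = z := by simpa using h7
              exact Or.inr ⟨sen, by simpa using hm, Vars.sc_prefix (hp _) h4.2.2⟩
          · rw [Side.opp_opp] at hsp
            simp only [Vars.sc, hsp.2] at hz ⊢
            exact Or.inl hz
      · rw [e1.1]; exact .refl ..
    · intro s' y' i' sen' he hi hi1
      cases he
      have h5 : w.vars.sc s.opp i = some sen := by
        by_contra hc; exact h1 (Or.inr ⟨hi, hc⟩)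
      rw [e4.1, hw2]
      rcases hi.lt_or_eq with hlt | heq
      · have h6 : w.vars.sc s.opp (i + 1) = some y := by
          by_contra hc; exact h2 ⟨hlt, hc⟩
        rw [if_neg (by omega), e1.1, h6]
      · rw [if_pos ⟨e2, heq.symm, h5⟩]
        simp [Vars.sc, w.vars.short_push s.opp y, heq]
  · rename_i h1
    exact ⟨h, .refl .., fun _ _ _ _ hf => (h1 _ _ _ _ hf).elim⟩

end NodeRound

/-! ### A whole round: responses, tests and the remaining steps -/

section NodeRoundSpec

variable {V M X : Type*} [LinearOrder V] (A : BaseAlgorithm V M X)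

/-- What node `u` does when it reads its channel without setting `exit`. -/
structure ResponsesSpec (u : V) (ch : List (Msg V X)) (w w' : Work V M X) : Prop where
  evolves : Evolves u ch w w'
  flyConst : ∀ s y i sen, Msg.flyConst s y i sen ∈ ch → i ≤ (w.vars.short s.opp).length → 1 ≤ i →
    w'.vars.sc s.opp (i + 1) = some y
  testVID : ∀ x, Msg.testVID x ∈ ch → w'.vars.vID = x
  testFlyID : ∀ f, Msg.testFlyID (some f) ∈ ch → ¬ w.vars.noS → f ≠ u → w'.vars.flyID = f
  testCert_eq : ∀ y vid d, Msg.testCert y vid d ∈ ch → ¬ w.vars.noS → w'.vars.vID = vid →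
    d - 1 = w'.vars.cdist ∧ y ∈ w'.vars.cids ∧ (some y, .introCert u) ∈ w'.out
  testCert_ne : ∀ y vid d, Msg.testCert y vid d ∈ ch → ¬ w.vars.noS → w'.vars.vID ≠ vid →
    ∃ z, w'.vars.nextStop vid = some z ∧
      (w'.vars.propFlyID u → (some z, .testCert y vid d) ∈ w'.out)
  introCert : ∀ y, Msg.introCert y ∈ ch → y ∈ w'.vars.cids

theorem VarsEvolve.noS_iff {u : V} {ch : List (Msg V X)} {x x' : Vars V}
    (h : VarsEvolve u ch x x') : x'.noS ↔ x.noS := by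
  constructor
  · rintro ⟨h1, h2⟩
    have h3 := h.short .left
    have h4 := h.short .right
    simp only [Vars.short, h1, h2, List.prefix_nil] at h3 h4
    exact ⟨h3, h4⟩
  · rintro ⟨h1, h2⟩
    exact ⟨h.nil .left h1, h.nil .right h2⟩

theorem responses_spec {u : V} {ch : List (Msg V X)} {w : Work V M X}
    (h : (responses A u ch w).vars.exit = false) :
    ResponsesSpec u ch w (responses A u ch w) := by
  unfold responses at *
  dsimp only at *
  set w1 := ch.foldl (onTestLine A) w with hw1
  set w2 := ch.foldl (onFlyConst A) w1 with hw2
  set w3 := ch.foldl onTestVID w2 with hw3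
  set w4 := ch.foldl (onTestFlyID A u) w3 with hw4
  set w5 := ch.foldl (onTestCert A u) w4 with hw5
  set w6 := ch.foldl onIntroCert w5 with hw6
  have ht : ∀ a b c : Work V M X, Evolves u ch a b → Evolves u ch b c → Evolves u ch a c :=
    fun _ _ _ => Evolves.trans
  have ht' : ∀ a b c : Work V M X, CidsEvolve a b → CidsEvolve b c → CidsEvolve a c :=
    fun _ _ _ => CidsEvolve.trans
  -- No response resets `exit`, so its final value `0` is carried backwards through the six loops,
  -- starting with the last one.
  obtain ⟨g5, e6, s6⟩ := foldl_spec (f := onIntroCert) (G := fun w : Work V M X =>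
    w.vars.exit = false) CidsEvolve.refl ht' ch
    (fun w m _ hw => (onIntroCert_spec w m).1 ▸ hw) (fun w m _ _ => (onIntroCert_spec w m).2.1) w5 h
  obtain ⟨g4, e5, s5⟩ := foldl_spec (f := onTestCert A u) (G := fun w : Work V M X =>
    w.vars.exit = false) CidsEvolve.refl ht' ch
    (fun w m _ hw => (onTestCert_spec A hw).1) (fun w m _ hw => (onTestCert_spec A hw).2.1) w4 g5
  obtain ⟨g3, e4, s4⟩ := foldl_spec (f := onTestFlyID A u) (G := fun w : Work V M X =>
    w.vars.exit = false) (Evolves.refl u ch) ht ch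
    (fun w m _ hw => (onTestFlyID_spec A hw ch).1)
    (fun w m _ hw => (onTestFlyID_spec A hw ch).2.1) w3 g4
  obtain ⟨g2, e3, s3⟩ := foldl_spec (f := onTestVID) (G := fun w : Work V M X =>
    w.vars.exit = false) (Evolves.refl u ch) ht ch
    (fun w m _ hw => (onTestVID_vars hw).1 ▸ hw)
    (fun w m _ hw => evolves_of_vars_eq (onTestVID_vars hw).1 (onTestVID_ext w m)) w2 g3
  obtain ⟨g1, e2, s2⟩ := foldl_spec (f := onFlyConst A) (G := fun w : Work V M X =>
    w.vars.exit = false) (Evolves.refl u ch) ht ch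
    (fun w m hm hw => (onFlyConst_spec A (u := u) hw ch hm).1)
    (fun w m hm hw => (onFlyConst_spec A hw ch hm).2.1) w1 g2
  obtain ⟨-, e1, -⟩ := foldl_spec (f := onTestLine A) (G := fun w : Work V M X =>
    w.vars.exit = false) (Evolves.refl u ch) ht ch
    (fun w m _ hw => onTestLine_vars A hw ▸ hw)
    (fun w m _ hw => evolves_of_vars_eq (onTestLine_vars A hw) (onTestLine_ext A w m)) w g1
  rw [← hw6] at e6 s6
  rw [← hw5] at e5 s5
  rw [← hw4] at e4 s4
  rw [← hw3] at e3 s3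
  rw [← hw2] at e2 s2
  rw [← hw1] at e1
  have f5 : CidsEvolve w4 w6 := e5.trans e6
  have f4 : Evolves u ch w4 w6 := f5.evolves u ch
  have f3 := e4.trans f4
  have f2 := e3.trans f3
  refine ⟨e1.trans (e2.trans f2), ?_, ?_, ?_, ?_, ?_, ?_⟩
  · intro s y i sen hm hi h1
    obtain ⟨w', hg, ha, hb⟩ := s2 _ hm
    exact Vars.sc_prefix ((hb.trans f2).1.short _) ((onFlyConst_spec A (u := u) hg ch hm).2.2 s y i
      sen rfl (hi.trans ((e1.trans ha).1.short _).length_le) h1)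
  · intro x hm
    obtain ⟨w', hg, ha, hb⟩ := s3 _ hm
    have h1 := onTestVID_vars hg
    rw [(hb.trans f3).1.vID, h1.1]
    exact h1.2 x rfl
  · intro f hm hn hf
    obtain ⟨w', hg, ha, hb⟩ := s4 _ hm
    have h1 := (onTestFlyID_spec A hg ch).2.2 f rfl
      (fun h => hn (((e1.trans (e2.trans (e3.trans ha))).1.noS_iff).1 h))
    -- A later message could overwrite the flyover id only while it equals `u`, which `f ≠ u`
    -- excludes.
    rcases (hb.trans f4).1.fly with h2 | h2
    · rw [h2, h1]
    · exact (hf (h1.symm.trans h2.1)).elim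
  · intro y vid d hm hn hv
    obtain ⟨w', hg, ha, hb⟩ := s5 _ hm
    have hn' : ¬ w'.vars.noS := fun h => hn (((e1.trans (e2.trans (e3.trans (e4.trans
      (ha.evolves u ch))))).1.noS_iff).1 h)
    obtain ⟨-, h1, h2⟩ := onTestCert_spec A hg
    have h3 := (h1.trans (hb.trans e6)).evolves u ch
    obtain ⟨h4, h5, h6⟩ := (h2 y vid d rfl hn').1 (by rw [← h3.1.vID, hv])
    have h7 := hb.trans e6
    exact ⟨by rw [h3.1.cdist, h4], (h7.evolves u ch).1.cids h5, h7.2.mem h6⟩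
  · intro y vid d hm hn hv
    obtain ⟨w', hg, ha, hb⟩ := s5 _ hm
    have hn' : ¬ w'.vars.noS := fun h => hn (((e1.trans (e2.trans (e3.trans (e4.trans
      (ha.evolves u ch))))).1.noS_iff).1 h)
    obtain ⟨-, h1, h2⟩ := onTestCert_spec A hg
    have h3 := h1.trans (hb.trans e6)
    obtain ⟨⟨s, -, h4⟩, -⟩ := h3
    have h7 := hb.trans e6
    -- From here to the end of the responses only c-ids changes, so `nextStop` and `propFlyID` have
    -- the same value now as when the certificate was processed.
    rw [h4] at hv ⊢
    obtain ⟨z, hz, hz'⟩ := (h2 y vid d rfl hn').2 hv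
    exact ⟨z, hz, fun hp => h7.2.mem (hz' hp)⟩
  · intro y hm
    obtain ⟨w', hg, ha, hb⟩ := s6 _ hm
    exact (hb.evolves u ch).1.cids ((onIntroCert_spec w' _).2.2 y rfl)

/-- The basic checks that matter for a node whose `exit` variable stays `0`. -/
structure ChecksPassed (u : V) (x : Vars V) : Prop where
  root : x.L = [] → x.R ≠ [] → x.vID = 1 ∧ x.flyID = u
  cdist_root : x.vID = 1 → x.cdist = 0
  cdist_pos : x.vID > 1 → 0 < x.cdist
  nextStop : ¬ x.noS → x.vID > 1 → x.nextStop x.cpar ≠ none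
  card_le : x.cids.card ≤ 2
  not_lt : x.cids.card = 2 → ¬ ∀ y ∈ x.cids, y < u
  not_gt : x.cids.card = 2 → ¬ ∀ y ∈ x.cids, u < y

theorem basicChecks_spec {u : V} {ch : List (Msg V X)} {x : Vars V}
    (h : (basicChecks u ch x).exit = false) : basicChecks u ch x = x ∧ ChecksPassed u x := by
  unfold basicChecks at *
  split_ifs at * with h1
  · simp [Vars.setExit] at h
  · simp only [not_or] at h1
    obtain ⟨-, -, -, h4, h5, h6, h7, h8, h9, h10⟩ := h1
    refine ⟨rfl, ⟨?_, ?_, ?_, ?_, ?_, ?_, ?_⟩⟩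
    · intro a b; by_contra hc; exact h4 ⟨⟨a, b⟩, by tauto⟩
    · intro a; by_contra hc; exact h5 ⟨a, hc⟩
    · intro a; by_contra hc; exact h6 ⟨a, by omega⟩
    · intro a b hc; exact h7 ⟨⟨a, b⟩, hc⟩
    · omega
    · exact fun a b => h9 ⟨a, b⟩
    · exact fun a b => h10 ⟨a, b⟩

/-- With `exit` at `0` after the checks, `rejectFlyover` does nothing and the responses start from
the variables of the configuration. -/
theorem KeepsExitZero.spec {A : BaseAlgorithm V M X} {c : Config V M X} {u : V}
    (h : KeepsExitZero A c u) : ChecksPassed u (c.vars u) ∧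
      ResponsesSpec u (c.chan u) ⟨c.vars u, c.mem u, []⟩ (afterResponses A c u) := by
  obtain ⟨h1, h2⟩ := h
  have h3 := basicChecks_spec h1
  refine ⟨h3.2, ?_⟩
  have h4 : rejectFlyover A u ⟨afterChecks c u, c.mem u, []⟩ = ⟨c.vars u, c.mem u, []⟩ := by
    unfold rejectFlyover
    rw [if_neg (by simp [h1])]
    exact congrArg (fun x => (⟨x, c.mem u, []⟩ : Work V M X)) h3.1
  unfold afterResponses at *
  rw [h4] at h2 ⊢
  exact responses_spec A h2

/-! ### Tests -/

theorem foldl_vars {N : Type*} (f : Work V M X → N → Work V M X)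
    (hf : ∀ w n, (f w n).vars = w.vars) (l : List N) (w : Work V M X) :
    (l.foldl f w).vars = w.vars := by
  induction l generalizing w with
  | nil => rfl
  | cons a l ih => exact (ih _).trans (hf w a)

theorem subset_foldl_out {N : Type*} (f : Work V M X → N → Work V M X)
    (hf : ∀ w n, w.out ⊆ (f w n).out) (l : List N) (w : Work V M X) :
    w.out ⊆ (l.foldl f w).out := by
  induction l generalizing w with
  | nil => exact List.Subset.refl _
  | cons a l ih => exact fun _ hq => ih _ (hf w a hq)

/-- A fold of steps that only send messages sends everything its steps send. -/
theorem mem_foldl_out {N : Type*} (f : Work V M X → N → Work V M X)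
    (hf : ∀ w n, w.out ⊆ (f w n).out) {l : List N} {n : N} (hn : n ∈ l)
    {p : Option V × Msg V X} (hp : ∀ w, p ∈ (f w n).out) (w : Work V M X) :
    p ∈ (l.foldl f w).out := by
  induction l generalizing w with
  | nil => simp at hn
  | cons a l ih =>
    rcases List.mem_cons.1 hn with rfl | hn
    · exact subset_foldl_out f hf l _ (hp w)
    · exact ih hn _

theorem Work.subset_sendOpt (w : Work V M X) (d : Option V) (m : Msg V X) :
    w.out ⊆ (w.sendOpt d m).out := by
  cases d
  · exact List.Subset.refl _
  · exact List.subset_append_left _ _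

theorem Work.mem_sendOpt (w : Work V M X) (d : V) (m : Msg V X) :
    (some d, m) ∈ (w.sendOpt (some d) m).out := by
  simp [Work.sendOpt, Work.send]

theorem Vars.sc_level {x : Vars V} {s : Side} {i : ℕ} {z : V} (h : x.sc s i = some z) :
    1 ≤ i ∧ i ≤ (x.short s).length ∧ z ∈ x.short s := by
  unfold Vars.sc at h
  split_ifs at h with h0
  refine ⟨by omega, ?_, List.mem_of_getElem? h⟩
  have := (List.getElem?_eq_some_iff.1 h).1
  omega

theorem mem_levels {i n : ℕ} (h : 1 ≤ i) (h' : i ≤ n) : i ∈ (List.range n).map (· + 1) :=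
  List.mem_map.2 ⟨i - 1, List.mem_range.2 (by omega), by omega⟩

/-- The step in which node `u` with variables `x` sends its `FlyConst` messages of level `i`. -/
def flyConstStep (u : V) (x : Vars V) (w : Work V M X) (i : ℕ) : Work V M X :=
  match x.sc .left i, x.sc .right i with
  | some l, some r =>
    (w.send (some r) (.flyConst .right l i u)).send (some l) (.flyConst .left r i u)
  | _, _ => w

theorem testFlyoverConstruction_eq (u : V) (w : Work V M X) : testFlyoverConstruction u w =
    ((List.range (min w.vars.R.length w.vars.L.length)).map (· + 1)).foldl (flyConstStep u w.vars)
      ((w.sendOpt (w.vars.sc .right 1) (.testLine .right u)).sendOpt (w.vars.sc .left 1)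
        (.testLine .left u)) := rfl

theorem flyConstStep_vars (u : V) (x : Vars V) (w : Work V M X) (i : ℕ) :
    (flyConstStep u x w i).vars = w.vars := by
  unfold flyConstStep; split <;> rfl

theorem subset_flyConstStep (u : V) (x : Vars V) (w : Work V M X) (i : ℕ) :
    w.out ⊆ (flyConstStep u x w i).out := by
  unfold flyConstStep
  split
  · exact fun p hp => by simp [Work.send, hp]
  · exact List.Subset.refl _

theorem testFlyoverConstruction_vars (u : V) (w : Work V M X) :
    (testFlyoverConstruction u w).vars = w.vars := by
  rw [testFlyoverConstruction_eq, foldl_vars _ (flyConstStep_vars u _)]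
  simp

theorem subset_testFlyoverConstruction (u : V) (w : Work V M X) :
    w.out ⊆ (testFlyoverConstruction u w).out := by
  rw [testFlyoverConstruction_eq]
  exact fun p hp => subset_foldl_out _ (subset_flyConstStep u _) _ _
    (Work.subset_sendOpt _ _ _ (Work.subset_sendOpt _ _ _ hp))

theorem mem_testFlyoverConstruction {u : V} {w : Work V M X} {i : ℕ} {s : Side} {y z : V}
    (hy : w.vars.sc s.opp i = some y) (hz : w.vars.sc s i = some z) :
    (some z, .flyConst s y i u) ∈ (testFlyoverConstruction u w).out := by
  rw [testFlyoverConstruction_eq]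
  obtain ⟨h1, h2, -⟩ := Vars.sc_level hy
  obtain ⟨-, h3, -⟩ := Vars.sc_level hz
  refine mem_foldl_out _ (subset_flyConstStep u _) (n := i) (mem_levels h1 ?_) (fun w' => ?_) _
  · cases s <;> exact le_min (by assumption) (by assumption)
  · unfold flyConstStep
    cases s <;> simp only [Side.opp] at hy <;> simp [hy, hz, Work.send]

/-- Soundness of the construction messages, which alone need it: a shortcut may be appended on the
strength of such a message, so its content has to be traced back to the sender's own shortcuts. -/
theorem of_mem_testFlyoverConstruction {u : V} {w : Work V M X} {d : Option V} {s : Side} {y : V}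
    {i : ℕ} {sen : V} (h : (d, .flyConst s y i sen) ∈ (testFlyoverConstruction u w).out)
    (hw : ∀ p ∈ w.out, ¬ p.2.IsFlyConst) : sen = u ∧ w.vars.sc s.opp i = some y := by
  rw [testFlyoverConstruction_eq] at h
  set w0 := (w.sendOpt (w.vars.sc .right 1) (.testLine .right u)).sendOpt (w.vars.sc .left 1)
    (.testLine .left u) with hw0
  have h0 : ∀ p ∈ w0.out, ¬ p.2.IsFlyConst := fun p hp hf => hw p
    (((Work.Ext.sendOpt _ _ (m := .testLine .right u) id).trans
      (.sendOpt _ _ (m := .testLine .left u) id)).mem_of_isFlyConst hp hf) hf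
  clear_value w0
  generalize (List.range (min w.vars.R.length w.vars.L.length)).map (· + 1) = l at h
  have key : ∀ (l : List ℕ) (w1 : Work V M X), (d, Msg.flyConst s y i sen) ∈
      (l.foldl (flyConstStep u w.vars) w1).out → (d, Msg.flyConst s y i sen) ∈ w1.out ∨
        (sen = u ∧ w.vars.sc s.opp i = some y) := by
    intro l
    induction l with
    | nil => exact fun w1 h => Or.inl h
    | cons a l ih =>
      intro w1 h
      rcases ih _ h with h1 | h1
      · unfold flyConstStep at h1
        split at h1
        · rename_i l r hl hr
          simp only [Work.send, List.append_assoc, List.mem_append, List.mem_singleton,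
            Prod.mk.injEq, Msg.flyConst.injEq] at h1
          rcases h1 with h1 | ⟨-, rfl, rfl, rfl, rfl⟩ | ⟨-, rfl, rfl, rfl, rfl⟩
          · exact Or.inl h1
          · exact Or.inr ⟨rfl, hl⟩
          · exact Or.inr ⟨rfl, hr⟩
        · exact Or.inl h1
      · exact Or.inr h1
  rcases key l w0 h with h1 | h1
  · exact (h0 _ h1 trivial).elim
  · exact h1

/-- The part of `TestFlyoverMetadata` that sends `TestFlyID` messages. -/
def sendFlyIDs (u : V) (ch : List (Msg V X)) (w : Work V M X) : Work V M X :=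
  let x := w.vars
  let w := if x.propFlyID u
    then w.sendAll ((allIds A u ch w).erase x.flyID) (.testFlyID (some x.flyID)) else w
  if x.noS ∧ x.vID = 0 then w.sendAll (allIds A u ch w) (.testFlyID none) else w

theorem testFlyoverMetadata_eq (u : V) (ch : List (Msg V X)) (w : Work V M X) :
    testFlyoverMetadata A u ch w =
      ((List.range w.vars.L.length).map (· + 1)).foldl (fun w' i =>
        w'.sendOpt (w.vars.sc .left i) (.testVID (w.vars.vID - 2 ^ (i - 1))))
      (((List.range w.vars.R.length).map (· + 1)).foldl (fun w' i =>
        w'.sendOpt (w.vars.sc .right i) (.testVID (w.vars.vID + 2 ^ (i - 1))))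
        (sendFlyIDs A u ch w)) := rfl

theorem sendFlyIDs_ext (u : V) (ch : List (Msg V X)) (w : Work V M X) :
    w.Ext (sendFlyIDs A u ch w) := by
  unfold sendFlyIDs
  dsimp only
  refine .trans (?_ : w.Ext _) (.ite (.sendAll _ _ id) (.refl _))
  exact .ite (.sendAll _ _ id) (.refl _)

theorem sendFlyIDs_vars (u : V) (ch : List (Msg V X)) (w : Work V M X) :
    (sendFlyIDs A u ch w).vars = w.vars := by
  unfold sendFlyIDs
  dsimp only
  split_ifs <;> rfl

theorem mem_sendFlyIDs {u : V} {ch : List (Msg V X)} {w : Work V M X} (h : w.vars.propFlyID u)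
    {z : V} (hz : z ∈ w.vars.S) (hu : z ≠ u) (hf : z ≠ w.vars.flyID) :
    (some z, .testFlyID (some w.vars.flyID)) ∈ (sendFlyIDs A u ch w).out := by
  have h1 : (some z, Msg.testFlyID (some w.vars.flyID)) ∈ (w.sendAll ((allIds A u ch w).erase
    w.vars.flyID) (.testFlyID (some w.vars.flyID))).out := by
    simp [Work.sendAll, allIds, hu, hf, hz]
  unfold sendFlyIDs
  simp only [if_pos h]
  split_ifs
  · simp only [Work.sendAll, List.mem_append] at h1 ⊢
    exact Or.inl h1
  · exact h1

theorem testFlyoverMetadata_vars (u : V) (ch : List (Msg V X)) (w : Work V M X) :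
    (testFlyoverMetadata A u ch w).vars = w.vars := by
  rw [testFlyoverMetadata_eq, foldl_vars _ (by simp), foldl_vars _ (by simp), sendFlyIDs_vars]

theorem testFlyoverMetadata_ext (u : V) (ch : List (Msg V X)) (w : Work V M X) :
    w.Ext (testFlyoverMetadata A u ch w) := by
  rw [testFlyoverMetadata_eq]
  refine (sendFlyIDs_ext A u ch w).trans (.trans (.foldl _ (fun w' i => ?_) _ _)
    (.foldl _ (fun w' i => ?_) _ _))
  exacts [.sendOpt _ _ id, .sendOpt _ _ id]

def Side.sgn : Side → ℤ
  | .left => -1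
  | .right => 1

theorem mem_testFlyoverMetadata {u : V} {ch : List (Msg V X)} {w : Work V M X} {s : Side} {i : ℕ}
    {z : V} (h : w.vars.sc s i = some z) :
    (some z, .testVID (w.vars.vID + s.sgn * 2 ^ (i - 1))) ∈ (testFlyoverMetadata A u ch w).out := by
  rw [testFlyoverMetadata_eq]
  obtain ⟨h1, h2, -⟩ := Vars.sc_level h
  cases s with
  | left =>
    refine mem_foldl_out _ (fun _ _ => Work.subset_sendOpt _ _ _) (n := i) (mem_levels h1 h2)
      (fun w' => ?_) _
    have e : w.vars.vID + Side.sgn .left * 2 ^ (i - 1) = w.vars.vID - 2 ^ (i - 1) := by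
      simp only [Side.sgn]; ring
    rw [h, e]
    exact Work.mem_sendOpt _ _ _
  | right =>
    refine Work.Ext.mem (.foldl _ (fun w' i => .sendOpt _ _ id) _ _) ?_
    refine mem_foldl_out _ (fun _ _ => Work.subset_sendOpt _ _ _) (n := i) (mem_levels h1 h2)
      (fun w' => ?_) _
    have e : w.vars.vID + Side.sgn .right * 2 ^ (i - 1) = w.vars.vID + 2 ^ (i - 1) := by
      simp only [Side.sgn]; ring
    rw [h, e]
    exact Work.mem_sendOpt _ _ _

theorem testConnCert_vars (u : V) (w : Work V M X) : (testConnCert u w).vars = w.vars := by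
  unfold testConnCert
  dsimp only
  split_ifs
  · simp
  · rfl

theorem testConnCert_ext (u : V) (w : Work V M X) : w.Ext (testConnCert u w) := by
  unfold testConnCert
  dsimp only
  split_ifs
  exacts [.sendOpt _ _ id, .refl _]

theorem tests_vars (u : V) (ch : List (Msg V X)) (w : Work V M X) :
    (tests A u ch w).vars = w.vars := by
  rw [tests, testConnCert_vars, testFlyoverMetadata_vars, testFlyoverConstruction_vars]

/-- The messages that node `u` with variables `x` sends in its tests. -/
structure TestsSpec (u : V) (x : Vars V) (o : List (Option V × Msg V X)) : Prop where
  flyConst : ∀ s i y z, x.sc s.opp i = some y → x.sc s i = some z →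
    (some z, .flyConst s y i u) ∈ o
  testVID : ∀ s i z, x.sc s i = some z → (some z, .testVID (x.vID + s.sgn * 2 ^ (i - 1))) ∈ o
  testFlyID : x.propFlyID u → ∀ z ∈ x.S, z ≠ u → z ≠ x.flyID →
    (some z, .testFlyID (some x.flyID)) ∈ o
  testCert : x.vID > 1 → x.flyID ≠ u → ∀ z, x.nextStop x.cpar = some z →
    (some z, .testCert u x.cpar x.cdist) ∈ o

theorem tests_spec (u : V) (ch : List (Msg V X)) (w : Work V M X) :
    TestsSpec u w.vars (tests A u ch w).out := by
  have h1 := testFlyoverConstruction_vars u w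
  have h2 := testFlyoverMetadata_vars A u ch (testFlyoverConstruction u w)
  have e2 := testFlyoverMetadata_ext A u ch (testFlyoverConstruction u w)
  have e3 := testConnCert_ext u (testFlyoverMetadata A u ch (testFlyoverConstruction u w))
  refine ⟨fun s i y z hy hz => (e2.trans e3).mem (mem_testFlyoverConstruction hy hz), ?_, ?_, ?_⟩
  · intro s i z hz
    refine e3.mem ?_
    rw [← h1] at hz ⊢
    exact mem_testFlyoverMetadata A hz
  · intro hp z hz hu hf
    refine e3.mem ?_
    rw [testFlyoverMetadata_eq]
    refine Work.Ext.mem (.trans (.foldl _ (fun w' i => .sendOpt _ _ id) _ _)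
      (.foldl _ (fun w' i => .sendOpt _ _ id) _ _)) ?_
    rw [← h1] at hp hz hf ⊢
    exact mem_sendFlyIDs A hp hz hu hf
  · intro hv hf z hz
    rw [← h1, ← h2] at hv hf hz ⊢
    unfold tests testConnCert
    simp only [if_pos (And.intro hv hf), hz]
    exact Work.mem_sendOpt _ _ _

/-! ### The end of the round -/

/-- The virtual id is reset only for nodes without shortcuts or with `exit` set, so only the timer
can change. -/
theorem basicChecks2_spec {x : Vars V} (hn : ¬ x.noS) (he : x.exit = false) :
    ∃ t, basicChecks2 x = { x with t := t } := by
  have key : ∀ b : Vars V, (∃ t, b = { x with t := t }) →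
      ∃ t, (if b.t ≤ 1 ∧ (b.noS ∨ b.exit) then { b with vID := 0 } else b) = { x with t := t } := by
    rintro _ ⟨t, rfl⟩
    refine ⟨t, if_neg ?_⟩
    rintro ⟨-, h | h⟩
    · exact hn h
    · simp [he] at h
  refine key _ ?_
  split_ifs <;> exact ⟨_, rfl⟩

/-- This is what shields flyover nodes from the supervisor: with a shortcut present, advice and path
messages cannot alter the variables. -/
theorem handling_eq_false {x : Vars V} (hn : ¬ x.noS) : handling x = false := by
  simp [handling, hn]

theorem snapshotReq_ext (u : V) (ch : List (Msg V X)) (w : Work V M X) :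
    w.Ext (snapshotReq A u ch w) := by
  unfold snapshotReq
  split_ifs
  · refine Work.Ext.trans ?_ (.send _ _ id)
    refine Work.Ext.trans ?_ (.foldl _ (fun w' i => .send _ _ id) _ _)
    exact (Work.Ext.of_out_eq rfl).trans (.sendAll _ _ id)
  · exact .refl _

theorem snapshotReq_eq (u : V) (ch : List (Msg V X)) {w : Work V M X} (hn : ¬ w.vars.noS) :
    snapshotReq A u ch w = w := by
  unfold snapshotReq
  rw [if_neg (by tauto)]

theorem getAdvice_ext (u : V) (ch : List (Msg V X)) (w : Work V M X) :
    w.Ext (getAdvice A u ch w) := by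
  unfold getAdvice
  dsimp only
  refine Work.Ext.trans ?_ (.of_out_eq rfl)
  split
  · exact .refl _
  · split_ifs
    · exact (Work.Ext.of_out_eq rfl).trans (.sendOpt _ _ id)
    · exact .refl _

theorem getAdvice_vars (u : V) (ch : List (Msg V X)) {w : Work V M X} (hn : ¬ w.vars.noS) :
    (getAdvice A u ch w).vars = w.vars := by
  unfold getAdvice
  dsimp only
  rw [flush_vars]
  split
  · rfl
  · rw [if_neg (by simp [handling_eq_false hn])]

theorem setupLocalTransform_ext (u : V) (s : Finset V) (w : Work V M X) :
    w.Ext (setupLocalTransform u s w) := by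
  unfold setupLocalTransform
  dsimp only
  refine Work.Ext.trans ?_ (.foldl _ (fun w' i => .send _ _ id) _ _)
  refine Work.Ext.trans ?_ (.foldl _ (fun w' i => (Work.Ext.send _ _ id).trans (.send _ _ id)) _ _)
  exact .sendAll _ _ id

theorem certifyTree_ext (u : V) (ch : List (Msg V X)) (w : Work V M X) :
    w.Ext (certifyTree A u ch w) := by
  unfold certifyTree
  dsimp only
  refine Work.Ext.trans ?_ (.of_out_eq rfl)
  split_ifs
  exacts [setupLocalTransform_ext _ _ _, .refl _]

theorem certifyTree_vars (u : V) (ch : List (Msg V X)) {w : Work V M X} (hn : ¬ w.vars.noS) :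
    (certifyTree A u ch w).vars = w.vars := by
  unfold certifyTree
  dsimp only
  rw [flush_vars, if_neg (by simp [handling_eq_false hn])]

theorem executeTransform_ext (u p : V) (a b : Option V) (s : Finset V) (w : Work V M X) :
    w.Ext (executeTransform u p a b s w) := by
  unfold executeTransform
  dsimp only
  split_ifs
  exacts [(Work.Ext.send _ _ id).trans (.send _ _ id), (Work.Ext.send _ _ id).trans (.send _ _ id),
    .refl _]

theorem executeTransform_vars (u p : V) (a b : Option V) (s : Finset V) (w : Work V M X) :
    (executeTransform u p a b s w).vars = w.vars := by
  unfold executeTransform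
  dsimp only
  split_ifs <;> rfl

theorem localTransform_ext (u : V) (ch : List (Msg V X)) (w : Work V M X) :
    w.Ext (localTransform A u ch w) := by
  unfold localTransform
  dsimp only
  refine Work.Ext.trans ?_ (.of_out_eq rfl)
  split
  · exact .refl _
  · split_ifs
    exacts [executeTransform_ext .., .refl _]

theorem localTransform_vars (u : V) (ch : List (Msg V X)) (w : Work V M X) :
    (localTransform A u ch w).vars = w.vars := by
  unfold localTransform
  dsimp only
  rw [flush_vars]
  split
  · rfl
  · split_ifs
    exacts [executeTransform_vars .., rfl]

theorem Join.add_ignore {x : Vars V} {j : Join V} (h : j.ignore = true) (s : Side) (v : V) :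
    (j.add x s v).ignore = true := by
  cases s <;> simp [Join.add, h]

theorem joinPath_ext (ch : List (Msg V X)) (w : Work V M X) : w.Ext (joinPath A ch w) := by
  unfold joinPath
  dsimp only
  refine Work.Ext.trans ?_ (.of_out_eq rfl)
  split_ifs
  exacts [.of_out_eq rfl, .refl _]

theorem joinPath_vars (ch : List (Msg V X)) {w : Work V M X} (hn : ¬ w.vars.noS) :
    (joinPath A ch w).vars = w.vars := by
  -- A node that is not handling enters the loop with `ignore` set, and no iteration clears it.
  have key : ∀ (l : List (Msg V X)) (j : Join V), j.ignore = true →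
      (l.foldl (fun j m => match m with | .path s v => j.add w.vars s v | _ => j) j).ignore
        = true := by
    intro l
    induction l with
    | nil => exact fun j h => h
    | cons a l ih =>
      intro j h
      refine ih _ ?_
      dsimp only
      split
      exacts [Join.add_ignore h _ _, h]
  unfold joinPath
  dsimp only
  rw [flush_vars, if_neg]
  intro hc
  exact Bool.false_ne_true (hc.symm.trans (key ch _ (by simp [handling_eq_false hn])))

theorem adviceHandling_ext (u : V) (ch : List (Msg V X)) (w : Work V M X) :
    w.Ext (adviceHandling A u ch w) :=
  (Work.Ext.of_out_eq (w' := { w with vars := basicChecks2 w.vars }) rfl).trans <|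
    (snapshotReq_ext A u ch _).trans <| (getAdvice_ext A u ch _).trans <| (certifyTree_ext A u ch _).trans <|
    (localTransform_ext A u ch _).trans (joinPath_ext A ch _)

theorem adviceHandling_vars (u : V) (ch : List (Msg V X)) {w : Work V M X} (hn : ¬ w.vars.noS)
    (he : w.vars.exit = false) :
    ∃ t, (adviceHandling A u ch w).vars = { w.vars with t := t } := by
  obtain ⟨t, ht⟩ := basicChecks2_spec hn he
  refine ⟨t, ?_⟩
  set x : Vars V := { w.vars with t := t } with hx
  have hn' : ¬ x.noS := hn
  unfold adviceHandling
  dsimp only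
  rw [ht, snapshotReq_eq A u ch (by exact hn')]
  have h1 := getAdvice_vars A u ch (w := { w with vars := x }) hn'
  have h2 := certifyTree_vars A u ch (w := getAdvice A u ch { w with vars := x }) (h1 ▸ hn')
  have h3 := localTransform_vars A u ch (certifyTree A u ch (getAdvice A u ch { w with vars := x }))
  rw [joinPath_vars, h3, h2, h1]
  rw [h3, h2, h1]
  exact hn'

/-- The arbitrary base algorithm cannot forge flyover messages, since everything it sends is wrapped
in `base`. -/
theorem runBase_ext (u : V) (ch : List (Msg V X)) (w : Work V M X) :
    w.Ext (runBase A u ch w) := by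
  refine ⟨_, rfl, ?_⟩
  intro p hp
  obtain ⟨q, -, rfl⟩ := List.mem_map.1 hp
  exact id

theorem endOfRound_ext (c : Config V M X) (u : V) :
    (tests A u (c.chan u) (afterResponses A c u)).Ext (endOfRound A c u) :=
  (adviceHandling_ext ..).trans (runBase_ext ..)

theorem mem_endOfRound_of_mem_afterResponses {c : Config V M X} {u : V} {p : Option V × Msg V X}
    (hp : p ∈ (afterResponses A c u).out) : p ∈ (endOfRound A c u).out :=
  (endOfRound_ext A c u).mem (((testFlyoverMetadata_ext ..).trans (testConnCert_ext ..)).mem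
    (subset_testFlyoverConstruction _ _ hp))

/-- Links consecutive rounds: apart from the timer, the values read after the responses are those
with which the next round begins. -/
theorem endOfRound_vars {c : Config V M X} {u : V} (hn : ¬ (inRound A c u).noS)
    (h : KeepsExitZero A c u) : ∃ t, (endOfRound A c u).vars = { inRound A c u with t := t } := by
  have h1 := tests_vars A u (c.chan u) (afterResponses A c u)
  obtain ⟨t, ht⟩ := adviceHandling_vars A u (c.chan u)
    (w := tests A u (c.chan u) (afterResponses A c u)) (h1 ▸ hn) (h1 ▸ h.2)
  refine ⟨t, ?_⟩
  change (adviceHandling A u _ _).vars = _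
  rw [ht, h1]
  rfl

theorem endOfRound_testsSpec (c : Config V M X) (u : V) :
    TestsSpec u (inRound A c u) (endOfRound A c u).out := by
  have h := tests_spec A u (c.chan u) (afterResponses A c u)
  have e := endOfRound_ext A c u
  exact ⟨fun s i y z hy hz => e.mem (h.flyConst s i y z hy hz),
    fun s i z hz => e.mem (h.testVID s i z hz),
    fun hp z hz hu hf => e.mem (h.testFlyID hp z hz hu hf),
    fun hv hf z hz => e.mem (h.testCert hv hf z hz)⟩

theorem onFlyConst_ext (w : Work V M X) (m : Msg V X) : w.Ext (onFlyConst A w m) := by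
  unfold onFlyConst
  split
  · dsimp only
    refine .trans (?_ : w.Ext _) (.ite (.sendRejFly A _ _) (.refl _))
    refine .trans ?_ (.ite (.of_out_eq rfl) (.refl _))
    refine .trans ?_ (.ite (.of_out_eq rfl) (.refl _))
    refine .trans ?_ (.ite (.of_out_eq rfl) (.refl _))
    exact .ite (.of_out_eq rfl) (.refl _)
  · exact .refl _

theorem onTestFlyID_ext (u : V) (w : Work V M X) (m : Msg V X) :
    w.Ext (onTestFlyID A u w m) := by
  unfold onTestFlyID
  split
  · dsimp only
    refine .trans (?_ : w.Ext _) (.ite (.sendRejFly A _ _) (.refl _))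
    refine .trans ?_ (.ite (.of_out_eq rfl) (.refl _))
    refine .trans ?_ (.ite (.of_out_eq rfl) (.refl _))
    exact .ite (.of_out_eq rfl) (.refl _)
  · exact .refl _

theorem onTestCert_ext (u : V) (w : Work V M X) (m : Msg V X) : w.Ext (onTestCert A u w m) := by
  unfold onTestCert
  split
  · dsimp only
    refine .trans (?_ : w.Ext _) (.ite (.sendRejFly A _ _) (.ite
      ((Work.Ext.of_out_eq rfl).trans (.send _ _ id)) (.ite (.sendOpt _ _ id) (.of_out_eq rfl))))
    refine .trans ?_ (.ite (.of_out_eq rfl) (.refl _))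
    exact .ite (.of_out_eq rfl) (.refl _)
  · exact .refl _

theorem rejectFlyover_ext (u : V) (w : Work V M X) : w.Ext (rejectFlyover A u w) := by
  unfold rejectFlyover
  split_ifs
  exacts [(Work.Ext.sendRejFly A _ _).trans (.of_out_eq rfl), .refl _]

/-- No assumption on `exit` is made, so that a received construction message can be traced to its
sender whatever state that node is in. -/
theorem afterResponses_not_flyConst (c : Config V M X) (u : V) :
    ∀ p ∈ (afterResponses A c u).out, ¬ p.2.IsFlyConst := by
  intro p hp hf
  have h : (⟨afterChecks c u, c.mem u, []⟩ : Work V M X).Ext (afterResponses A c u) :=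
    (rejectFlyover_ext A u _).trans <| (Work.Ext.foldl _ (onTestLine_ext A) _ _).trans <|
      (Work.Ext.foldl _ (onFlyConst_ext A) _ _).trans <|
      (Work.Ext.foldl _ onTestVID_ext _ _).trans <|
      (Work.Ext.foldl _ (onTestFlyID_ext A u) _ _).trans <|
      (Work.Ext.foldl _ (onTestCert_ext A u) _ _).trans
      (.foldl _ (fun w m => (onIntroCert_spec w m).2.1.2) _ _)
  simpa using h.mem_of_isFlyConst hp hf

theorem endOfRound_flyConst {c : Config V M X} {u : V} {d : Option V} {s : Side} {y : V}
    {i : ℕ} {sen : V} (h : (d, .flyConst s y i sen) ∈ (endOfRound A c u).out) :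
    sen = u ∧ (inRound A c u).sc s.opp i = some y :=
  of_mem_testFlyoverConstruction (((testFlyoverMetadata_ext ..).trans
    ((testConnCert_ext ..).trans (endOfRound_ext A c u))).mem_of_isFlyConst h trivial)
    (afterResponses_not_flyConst A c u)

end NodeRoundSpec

/-! ### Rooted trees whose neighbourhoods respect a linear order -/

section SortedTree

/-- A parent function `p` with depth `d`, such that of two distinct tree neighbours of a node one is
smaller and one is larger than the node. -/
structure SortedTree {α : Type*} [LinearOrder α] (root : α) (p : α → α) (d : α → ℕ) : Prop where
  depth_root : d root = 0
  depth : ∀ a, a ≠ root → d a = d (p a) + 1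
  between : ∀ a b c, (a ≠ root ∧ p a = b) ∨ (b ≠ root ∧ p b = a) →
    (a ≠ root ∧ p a = c) ∨ (c ≠ root ∧ p c = a) → b < c → b < a ∧ a < c

namespace SortedTree

variable {α : Type*} [LinearOrder α] {root : α} {p : α → α} {d : α → ℕ}

/-- The condition is symmetric under reversal of the order, so only nodes above the root need to be
treated. -/
theorem dual (h : SortedTree root p d) : SortedTree (α := αᵒᵈ) root p d :=
  ⟨h.depth_root, h.depth, fun a b c hb hc hlt => (h.between a c b hc hb hlt).symm⟩

/-- A node `p a` below its child `a` must lie above its own parent, because its two neighbours are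
on different sides. Hence the path to the root keeps descending. -/
theorem root_le_parent (h : SortedTree root p d) {a : α} (ha : a ≠ root) (hlt : p a < a) :
    root ≤ p a := by
  induction hn : d a using Nat.strong_induction_on generalizing a with
  | _ n ih =>
    by_cases hp : p a = root
    · exact hp.ge
    have h1 := h.depth a ha
    have h2 := h.depth _ hp
    have hne : p (p a) ≠ a := fun hc => by rw [hc] at h2; omega
    rcases hne.lt_or_gt with h3 | h3
    · have h4 := h.between (p a) (p (p a)) a (Or.inl ⟨hp, rfl⟩) (Or.inr ⟨ha, rfl⟩) h3
      exact (ih (d (p a)) (by omega) hp h4.1 rfl).trans h4.1.le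
    · have h4 := h.between (p a) a (p (p a)) (Or.inr ⟨ha, rfl⟩) (Or.inl ⟨hp, rfl⟩) h3
      exact (lt_asymm hlt h4.1).elim

theorem parent_lt (h : SortedTree root p d) {a : α} (ha : root < a) : p a < a := by
  have hne : p a ≠ a := fun hc => by
    have := h.depth a ha.ne'
    rw [hc] at this
    omega
  refine hne.lt_or_gt.resolve_right fun hc => ?_
  have h1 : p a ≤ root := root_le_parent h.dual ha.ne' hc
  exact absurd (hc.trans_le h1) ha.not_gt

/-- If something lay strictly between `p a` and `a`, the element `s` covering `p a` would be below
`a`, and by induction its parent would be `p a` too. Then `p a` would have two children above it,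
which `between` forbids. -/
theorem parent_covBy [Finite α] (h : SortedTree root p d) {a : α} (ha : root < a) : p a ⋖ a := by
  induction a using WellFoundedLT.induction with
  | _ a ih =>
    refine ⟨h.parent_lt ha, fun w hw hwa => ?_⟩
    obtain ⟨s, hs, hsw⟩ := exists_covBy_le_of_lt hw
    have hsr : root < s := (h.root_le_parent ha.ne' (h.parent_lt ha)).trans_lt hs.lt
    have hsa : s < a := hsw.trans_lt hwa
    have h1 : p s = p a := (ih s hsa hsr).unique_left hs
    have h2 := h.between (p a) s a (Or.inr ⟨hsr.ne', h1⟩) (Or.inr ⟨ha.ne', rfl⟩) hsa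
    exact lt_asymm hs.lt h2.1

theorem covBy_parent [Finite α] (h : SortedTree root p d) {a : α} (ha : a < root) : a ⋖ p a :=
  (parent_covBy h.dual (a := a) ha).ofDual

/-- Every non-root node is joined by a covering pair to its parent, on the side of the root.
Conversely, in a covering pair the node farther from the root has the other one as its parent, since
covers are unique. -/
theorem adj_iff [Finite α] (h : SortedTree root p d) {a b : α} :
    (a ⋖ b ∨ b ⋖ a) ↔ (a ≠ root ∧ p a = b) ∨ (b ≠ root ∧ p b = a) := by
  have key : ∀ a b : α, a ⋖ b → (a ≠ root ∧ p a = b) ∨ (b ≠ root ∧ p b = a) := by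
    intro a b hab
    rcases le_or_gt b root with hb | hb
    · have ha := hab.lt.trans_le hb
      exact Or.inl ⟨ha.ne, (h.covBy_parent ha).unique_right hab⟩
    · exact Or.inr ⟨hb.ne', (h.parent_covBy hb).unique_left hab⟩
  have key' : ∀ a, a ≠ root → a ⋖ p a ∨ p a ⋖ a := fun a ha =>
    ha.lt_or_gt.imp h.covBy_parent h.parent_covBy
  constructor
  · rintro (h1 | h1)
    exacts [key a b h1, (key b a h1).symm]
  · rintro (⟨h1, rfl⟩ | ⟨h1, rfl⟩)
    exacts [key' a h1, (key' b h1).symm]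

end SortedTree

end SortedTree

/-! ### The graph of a parent function: distances and the tree property -/

section ParentGraph

variable {α : Type*} {G : SimpleGraph α} {root : α} {p : α → α} {d : α → ℕ}

theorem exists_walk_of_parent (hd : ∀ a, a ≠ root → d a = d (p a) + 1) (hr : d root = 0)
    (hG : ∀ a, a ≠ root → G.Adj a (p a)) (a : α) : ∃ w : G.Walk a root, w.length = d a := by
  induction hn : d a generalizing a with
  | zero =>
    by_cases h : a = root
    · subst h; exact ⟨.nil, rfl⟩
    · have := hd a h; omega
  | succ n ih =>
    have h : a ≠ root := by rintro rfl; omega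
    obtain ⟨w, hw⟩ := ih (p a) (by have := hd a h; omega)
    exact ⟨.cons (hG a h) w, by simp [hw]⟩

/-- Each edge lowers the depth by at most one. The end `b` stays a variable so that induction on the
walk applies. -/
theorem depth_le_length (hr : d root = 0) (hG : ∀ a b, G.Adj a b → d a ≤ d b + 1) {a b : α}
    (w : G.Walk a b) (hb : b = root) : d a ≤ w.length := by
  induction w with
  | nil => simp [hb, hr]
  | cons h w ih =>
    have h1 := hG _ _ h
    have h2 := ih hb
    simp only [SimpleGraph.Walk.length_cons]
    omega

theorem dist_root_eq_depth (hd : ∀ a, a ≠ root → d a = d (p a) + 1) (hr : d root = 0)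
    (hG : ∀ a b, G.Adj a b ↔ (a ≠ root ∧ p a = b) ∨ (b ≠ root ∧ p b = a)) (a : α) :
    G.dist a root = d a := by
  obtain ⟨w, hw⟩ := exists_walk_of_parent (G := G) hd hr
    (fun a ha => (hG _ _).2 (Or.inl ⟨ha, rfl⟩)) a
  refine le_antisymm (hw ▸ G.dist_le w) ?_
  obtain ⟨w', hw'⟩ := SimpleGraph.Reachable.exists_walk_length_eq_dist ⟨w⟩
  rw [← hw']
  refine depth_le_length hr (fun a b hab => ?_) w' rfl
  rcases (hG a b).1 hab with ⟨h1, rfl⟩ | ⟨h1, rfl⟩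
  · exact (hd a h1).le
  · have := hd b h1; omega

/-- Following parents connects everything to the root, and mapping each non-root vertex to its
parent edge hits all edges, so there is at most one edge fewer than vertices. -/
theorem isTree_of_parent [Finite α] (hd : ∀ a, a ≠ root → d a = d (p a) + 1) (hr : d root = 0)
    (hG : ∀ a b, G.Adj a b ↔ (a ≠ root ∧ p a = b) ∨ (b ≠ root ∧ p b = a)) : G.IsTree := by
  have hw := exists_walk_of_parent (G := G) hd hr (fun a ha => (hG _ _).2 (Or.inl ⟨ha, rfl⟩))
  have hc : G.Connected := by
    have : Nonempty α := ⟨root⟩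
    refine ⟨fun a b => ?_⟩
    obtain ⟨w, -⟩ := hw a
    obtain ⟨w', -⟩ := hw b
    exact SimpleGraph.Reachable.trans ⟨w⟩ (SimpleGraph.Reachable.symm ⟨w'⟩)
  refine SimpleGraph.isTree_iff_connected_and_card.2 ⟨hc, ?_⟩
  have h1 := hc.card_vert_le_card_edgeSet_add_one
  have h2 : Nat.card G.edgeSet ≤ Nat.card {a // a ≠ root} := by
    refine Nat.card_le_card_of_surjective (fun a : {a // a ≠ root} =>
      (⟨s(a.1, p a.1), (hG _ _).2 (Or.inl ⟨a.2, rfl⟩)⟩ : G.edgeSet)) ?_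
    rintro ⟨e, he⟩
    induction e with
    | _ a b =>
      rcases (hG a b).1 he with ⟨h, rfl⟩ | ⟨h, rfl⟩
      · exact ⟨⟨a, h⟩, rfl⟩
      · exact ⟨⟨b, h⟩, Subtype.ext Sym2.eq_swap⟩
  have h3 : Nat.card {a // a ≠ root} + 1 = Nat.card α := by
    classical
    have := Fintype.ofFinite α
    simp only [Nat.card_eq_fintype_card]
    rw [Fintype.card_subtype_compl, Fintype.card_subtype_eq]
    have : 0 < Fintype.card α := Fintype.card_pos_iff.2 ⟨root⟩
    omega
  omega

end ParentGraph

theorem sortedPath_adj {V : Type*} [LinearOrder V] {B : Finset V} {a b : B} :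
    (sortedPath B).Adj a b ↔ a ⋖ b ∨ b ⋖ a := by
  have key : ∀ a b : B, IsSuccIn B a b ↔ a ⋖ b := by
    intro a b
    constructor
    · rintro ⟨-, h1, h2⟩
      exact ⟨h1, fun c hac hcb => absurd (h2 c c.2 hac) (not_le.2 hcb)⟩
    · rintro ⟨h1, h2⟩
      exact ⟨b.2, h1, fun w hw haw => not_lt.1 fun hc => h2 (c := ⟨w, hw⟩) haw hc⟩
  exact or_congr (key a b) (key b a)

/-! ### Stable runs: persistence, shortcuts and flyover ids -/

section Execution

variable {V M X : Type*} [Fintype V] [LinearOrder V] {A : BaseAlgorithm V M X}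
  {C : ℕ → Config V M X}

theorem IsExecution.deliver (hC : IsExecution A C) {ρ : ℕ} (hρ : 1 ≤ ρ) {w z : V} {m : Msg V X}
    (h : (some z, m) ∈ (endOfRound A (C ρ) w).out) : m ∈ (C (ρ + 1)).chan z := by
  obtain ⟨-, -, sup, -, hs⟩ := hC ρ hρ z
  rw [← Multiset.mem_coe, hs, Multiset.mem_add, Multiset.mem_sum]
  exact Or.inr ⟨w, Finset.mem_univ _, List.mem_filterMap.2 ⟨_, h, by simp⟩⟩

/-- The supervisor does not send construction messages, so they come from nodes. This concerns
channels from round 2 on; the initial ones are arbitrary. -/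
theorem IsExecution.flyConst_origin (hC : IsExecution A C) {ρ : ℕ} (hρ : 1 ≤ ρ) {z : V} {s : Side}
    {y : V} {i : ℕ} {sen : V} (h : Msg.flyConst s y i sen ∈ (C (ρ + 1)).chan z) :
    (inRound A (C ρ) sen).sc s.opp i = some y := by
  obtain ⟨-, -, sup, hsup, hs⟩ := hC ρ hρ z
  rw [← Multiset.mem_coe, hs, Multiset.mem_add, Multiset.mem_sum] at h
  rcases h with h | ⟨w, -, h⟩
  · exact (hsup _ h).elim
  · obtain ⟨⟨dst, m⟩, hm, hm'⟩ := List.mem_filterMap.1 (Multiset.mem_coe.1 h)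
    split_ifs at hm'
    cases hm'
    obtain ⟨rfl, h1⟩ := endOfRound_flyConst A hm
    exact h1

theorem VarsEvolve.of_t {u : V} {ch : List (Msg V X)} {x x' : Vars V} {t : ℤ}
    (h : VarsEvolve u ch { x with t := t } x') : VarsEvolve u ch x x' where
  short s := by have := h.short s; cases s <;> exact this
  nil s := by have := h.nil s; cases s <;> exact this
  vID := h.vID
  cpar := h.cpar
  cdist := h.cdist
  cids := h.cids
  fly := h.fly
  origin s := by have := h.origin s; cases s <;> exact this

theorem VarsEvolve.mono {u : V} {ch ch' : List (Msg V X)} {x x' : Vars V}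
    (h : VarsEvolve u ch x x') (hs : ch ⊆ ch') : VarsEvolve u ch' x x' where
  short := h.short
  nil := h.nil
  vID := h.vID
  cpar := h.cpar
  cdist := h.cdist
  cids := h.cids
  fly := h.fly
  origin s l z hz := (h.origin s l z hz).imp id fun ⟨sen, h1, h2⟩ => ⟨sen, hs h1, h2⟩

theorem ChecksPassed.of_t {u : V} {x : Vars V} {t : ℤ} (h : ChecksPassed u { x with t := t }) :
    ChecksPassed u x :=
  ⟨h.root, h.cdist_root, h.cdist_pos, h.nextStop, h.card_le, h.not_lt, h.not_gt⟩

variable (A C) in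
/-- In round `r` the nodes `v 1, …, v |B|` form a backbone without wings, and none of them sets
`exit` in the rounds `r, …, T`. -/
structure IsStableRun (r T : ℕ) (B : Finset V) (v : ℕ → V) : Prop where
  exec : IsExecution A C
  one_le : 1 ≤ r
  spine : IsSpineOf (inRound A (C r)) B v
  left_end : (inRound A (C r) (v 1)).L = []
  right_end : (inRound A (C r) (v B.card)).R = []
  keeps : ∀ ρ, r ≤ ρ → ρ ≤ T → ∀ u ∈ B, KeepsExitZero A (C ρ) u

namespace IsStableRun

variable {r T : ℕ} {B : Finset V} {v : ℕ → V}

theorem mem (h : IsStableRun A C r T B v) {i : ℕ} (h1 : 1 ≤ i) (h2 : i ≤ B.card) : v i ∈ B :=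
  h.spine.bij.mapsTo ⟨h1, h2⟩

theorem inj (h : IsStableRun A C r T B v) {i j : ℕ} (hi : 1 ≤ i) (hi' : i ≤ B.card) (hj : 1 ≤ j)
    (hj' : j ≤ B.card) (he : v i = v j) : i = j :=
  h.spine.bij.injOn ⟨hi, hi'⟩ ⟨hj, hj'⟩ he

theorem exists_index (h : IsStableRun A C r T B v) {u : V} (hu : u ∈ B) :
    ∃ i, 1 ≤ i ∧ i ≤ B.card ∧ v i = u := by
  obtain ⟨i, ⟨h1, h2⟩, h3⟩ := h.spine.bij.surjOn hu
  exact ⟨i, h1, h2, h3⟩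

theorem not_noS_start (h : IsStableRun A C r T B v) {u : V} (hu : u ∈ B) :
    ¬ (inRound A (C r) u).noS := by
  obtain ⟨i, h1, h2, rfl⟩ := h.exists_index hu
  rintro ⟨hl, hr⟩
  have hn := h.spine.two_le
  by_cases hi : i = B.card
  · have := (h.spine.spine (i - 1) (by omega) (by omega)).2
    rw [Nat.sub_add_cancel h1] at this
    simp [Vars.sc, Vars.short, hl] at this
  · have := (h.spine.spine i h1 (by omega)).1
    simp [Vars.sc, Vars.short, hr] at this

theorem not_noS (h : IsStableRun A C r T B v) {u : V} (hu : u ∈ B) {ρ : ℕ} (h1 : r ≤ ρ)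
    (h2 : ρ ≤ T) : ¬ (inRound A (C ρ) u).noS := by
  induction ρ, h1 using Nat.le_induction with
  | base => exact h.not_noS_start hu
  | succ ρ h1 ih =>
    have ih := ih (by omega)
    obtain ⟨t, ht⟩ := endOfRound_vars A ih (h.keeps ρ h1 (by omega) u hu)
    have h3 := (h.keeps (ρ + 1) (by omega) h2 u hu).spec.2.evolves.1
    dsimp only at h3
    rw [(h.exec ρ (h.one_le.trans h1) u).1, ht] at h3
    exact fun hc => ih (h3.of_t.noS_iff.1 hc)

theorem exists_vars_eq (h : IsStableRun A C r T B v) {u : V} (hu : u ∈ B) {ρ : ℕ} (h1 : r ≤ ρ)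
    (h2 : ρ + 1 ≤ T) : ∃ t, (C (ρ + 1)).vars u = { inRound A (C ρ) u with t := t } := by
  obtain ⟨t, ht⟩ := endOfRound_vars A (h.not_noS hu h1 (by omega)) (h.keeps ρ h1 (by omega) u hu)
  exact ⟨t, (h.exec ρ (h.one_le.trans h1) u).1.trans ht⟩

theorem step (h : IsStableRun A C r T B v) {u : V} (hu : u ∈ B) {ρ : ℕ} (h1 : r ≤ ρ)
    (h2 : ρ + 1 ≤ T) : VarsEvolve u ((C (ρ + 1)).chan u) (inRound A (C ρ) u)
      (inRound A (C (ρ + 1)) u) := by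
  obtain ⟨t, ht⟩ := h.exists_vars_eq hu h1 h2
  have h3 := (h.keeps (ρ + 1) (by omega) h2 u hu).spec.2.evolves.1
  dsimp only at h3
  rw [ht] at h3
  exact h3.of_t

theorem evolve (h : IsStableRun A C r T B v) {u : V} (hu : u ∈ B) {ρ ρ' : ℕ} (h1 : r ≤ ρ)
    (h2 : ρ ≤ ρ') (h3 : ρ' ≤ T) :
    ∃ ch, VarsEvolve u (X := X) ch (inRound A (C ρ) u) (inRound A (C ρ') u) := by
  induction ρ', h2 using Nat.le_induction with
  | base => exact ⟨[], .refl ..⟩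
  | succ ρ' h2 ih =>
    obtain ⟨ch, hch⟩ := ih (by omega)
    exact ⟨ch ++ (C (ρ' + 1)).chan u, (hch.mono (List.subset_append_left _ _)).trans
      ((h.step hu (h1.trans h2) h3).mono (List.subset_append_right _ _))⟩

/-- The values of round `ρ` are inspected by the checks at the start of round `ρ + 1`, hence the
bound on `ρ + 1`. -/
theorem checks (h : IsStableRun A C r T B v) {u : V} (hu : u ∈ B) {ρ : ℕ} (h1 : r ≤ ρ)
    (h2 : ρ + 1 ≤ T) : ChecksPassed u (inRound A (C ρ) u) := by
  obtain ⟨t, ht⟩ := h.exists_vars_eq hu h1 h2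
  have h3 := (h.keeps (ρ + 1) (by omega) h2 u hu).spec.1
  rw [ht] at h3
  exact h3.of_t

theorem sc_mono (h : IsStableRun A C r T B v) {u : V} (hu : u ∈ B) {ρ ρ' : ℕ} (h1 : r ≤ ρ)
    (h2 : ρ ≤ ρ') (h3 : ρ' ≤ T) {s : Side} {i : ℕ} {z : V}
    (hz : (inRound A (C ρ) u).sc s i = some z) : (inRound A (C ρ') u).sc s i = some z := by
  obtain ⟨ch, hch⟩ := h.evolve hu h1 h2 h3
  exact Vars.sc_prefix (hch.short s) hz

/-! ### Received messages -/

/-- The doubling step: `u` lies between `y` and `z`, both at its level `i`, and `y` becomes the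
shortcut of `z` at level `i + 1`. The length hypothesis ensures that `z` is ready to append or
compare. -/
theorem recv_flyConst (h : IsStableRun A C r T B v) {u z y : V} (hz : z ∈ B) {ρ : ℕ} (h1 : r ≤ ρ)
    (h2 : ρ + 1 ≤ T) {s : Side} {i : ℕ} (hy : (inRound A (C ρ) u).sc s.opp i = some y)
    (hsz : (inRound A (C ρ) u).sc s i = some z)
    (hlen : i ≤ ((inRound A (C ρ) z).short s.opp).length) :
    (inRound A (C (ρ + 1)) z).sc s.opp (i + 1) = some y := by
  obtain ⟨t, ht⟩ := h.exists_vars_eq hz h1 h2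
  have hm := h.exec.deliver (h.one_le.trans h1)
    ((endOfRound_testsSpec A (C ρ) u).flyConst s i y z hy hsz)
  refine (h.keeps (ρ + 1) (by omega) h2 z hz).spec.2.flyConst _ _ _ _ hm ?_ (Vars.sc_level hy).1
  dsimp only
  rw [ht]
  cases s <;> exact hlen

theorem recv_testVID (h : IsStableRun A C r T B v) {u z : V} (hz : z ∈ B) {ρ : ℕ} (h1 : r ≤ ρ)
    (h2 : ρ + 1 ≤ T) {s : Side} {i : ℕ} (hsz : (inRound A (C ρ) u).sc s i = some z) :
    (inRound A (C (ρ + 1)) z).vID = (inRound A (C ρ) u).vID + s.sgn * 2 ^ (i - 1) :=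
  (h.keeps (ρ + 1) (by omega) h2 z hz).spec.2.testVID _
    (h.exec.deliver (h.one_le.trans h1) ((endOfRound_testsSpec A (C ρ) u).testVID s i z hsz))

theorem recv_testFlyID (h : IsStableRun A C r T B v) {u z : V} (hz : z ∈ B) {ρ : ℕ} (h1 : r ≤ ρ)
    (h2 : ρ + 1 ≤ T) (hp : (inRound A (C ρ) u).propFlyID u) (hS : z ∈ (inRound A (C ρ) u).S)
    (hu : z ≠ u) (hf : z ≠ (inRound A (C ρ) u).flyID) :
    (inRound A (C (ρ + 1)) z).flyID = (inRound A (C ρ) u).flyID := by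
  obtain ⟨t, ht⟩ := h.exists_vars_eq hz h1 h2
  refine (h.keeps (ρ + 1) (by omega) h2 z hz).spec.2.testFlyID _
    (h.exec.deliver (h.one_le.trans h1) ((endOfRound_testsSpec A (C ρ) u).testFlyID hp z hS hu hf))
    ?_ hf.symm
  dsimp only
  rw [ht]
  exact h.not_noS hz h1 (by omega)

theorem chan_not_noS (h : IsStableRun A C r T B v) {z : V} (hz : z ∈ B) {ρ : ℕ} (h1 : r ≤ ρ)
    (h2 : ρ ≤ T) : ¬ ((C ρ).vars z).noS :=
  fun hc => h.not_noS hz h1 h2 (((h.keeps ρ h1 h2 z hz).spec.2.evolves.1.noS_iff).2 hc)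

/-! ### Virtual ids, shortcuts and flyover ids -/

/-- With no left and some right shortcut, the check on `v 1` leaves these values as the only option.
An empty left list also bars it from adopting a foreign flyover id later. -/
theorem root_spec (h : IsStableRun A C r T B v) {ρ : ℕ} (h1 : r ≤ ρ) (h2 : ρ ≤ T)
    (hT : r + 1 ≤ T) : (inRound A (C ρ) (v 1)).L = [] ∧ (inRound A (C ρ) (v 1)).vID = 1 ∧
      (inRound A (C ρ) (v 1)).flyID = v 1 := by
  have hv := h.mem le_rfl (by have := h.spine.two_le; omega)
  obtain ⟨ch, hch⟩ := h.evolve hv le_rfl h1 h2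
  have h3 := (h.checks hv le_rfl hT).root h.left_end
    fun hc => h.not_noS_start hv ⟨h.left_end, hc⟩
  refine ⟨hch.nil .left h.left_end, hch.vID.trans h3.1, ?_⟩
  rcases hch.fly with h4 | h4
  · exact h4.trans h3.2
  · exact (h4.2 h.left_end).elim

theorem right_end_persists (h : IsStableRun A C r T B v) {ρ : ℕ} (h1 : r ≤ ρ) (h2 : ρ ≤ T) :
    (inRound A (C ρ) (v B.card)).R = [] := by
  have hv := h.mem (i := B.card) (by have := h.spine.two_le; omega) le_rfl
  obtain ⟨ch, hch⟩ := h.evolve hv le_rfl h1 h2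
  exact hch.nil .right h.right_end

/-- Virtual ids are frozen, so the level-1 tests sent in the single round `r` fix the whole chain,
in round `r` itself as well. -/
theorem vID_eq (h : IsStableRun A C r T B v) (hT : r + 1 ≤ T) {i : ℕ} (hi : 1 ≤ i)
    (hi' : i ≤ B.card) {ρ : ℕ} (h1 : r ≤ ρ) (h2 : ρ ≤ T) :
    (inRound A (C ρ) (v i)).vID = i := by
  induction i, hi using Nat.le_induction generalizing ρ with
  | base => exact_mod_cast (h.root_spec h1 h2 hT).2.1
  | succ i hi ih =>
    have hv := h.mem (i := i + 1) (by omega) hi'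
    have h3 := h.recv_testVID hv le_rfl hT (h.spine.spine i hi (by omega)).1
    rw [ih (by omega) le_rfl (by omega)] at h3
    obtain ⟨ch, hch⟩ := h.evolve hv le_rfl h1 h2
    obtain ⟨ch', hch'⟩ := h.evolve hv le_rfl (Nat.le_succ r) hT
    rw [hch.vID, ← hch'.vID, h3]
    simp [Side.sgn]

theorem shortcuts (h : IsStableRun A C r T B v) {j : ℕ} {ρ : ℕ} (h1 : r + j ≤ ρ)
    (h2 : ρ ≤ T) {i : ℕ} (hi : 1 ≤ i) (hij : i + 2 ^ j ≤ B.card) :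
    (inRound A (C ρ) (v i)).sc .right (j + 1) = some (v (i + 2 ^ j)) ∧
      (inRound A (C ρ) (v (i + 2 ^ j))).sc .left (j + 1) = some (v i) := by
  have hp : 0 < 2 ^ j := by positivity
  have mono : ∀ ρ₀, r ≤ ρ₀ → ρ₀ ≤ ρ →
      (inRound A (C ρ₀) (v i)).sc .right (j + 1) = some (v (i + 2 ^ j)) ∧
        (inRound A (C ρ₀) (v (i + 2 ^ j))).sc .left (j + 1) = some (v i) →
      (inRound A (C ρ) (v i)).sc .right (j + 1) = some (v (i + 2 ^ j)) ∧
        (inRound A (C ρ) (v (i + 2 ^ j))).sc .left (j + 1) = some (v i) := fun ρ₀ ha hb hc =>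
    ⟨h.sc_mono (h.mem hi (by omega)) ha hb h2 hc.1,
      h.sc_mono (h.mem (by omega) hij) ha hb h2 hc.2⟩
  induction j generalizing ρ i with
  | zero => exact mono r le_rfl (by omega) (h.spine.spine i hi (by simp at hij; omega))
  | succ j ih =>
    have hp' : 0 < 2 ^ j := by positivity
    have he : 2 ^ (j + 1) = 2 ^ j + 2 ^ j := by ring
    refine mono (r + (j + 1)) (by omega) h1 ?_
    have base : ∀ i, 1 ≤ i → i + 2 ^ j ≤ B.card →
        (inRound A (C (r + j)) (v i)).sc .right (j + 1) = some (v (i + 2 ^ j)) ∧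
        (inRound A (C (r + j)) (v (i + 2 ^ j))).sc .left (j + 1) = some (v i) := by
      intro i hi hij
      refine ih le_rfl (by omega) hi hij hp' fun ρ₀ ha hb hc => ?_
      exact ⟨h.sc_mono (h.mem hi (by omega)) ha hb (by omega) hc.1,
        h.sc_mono (h.mem (by omega) hij) ha hb (by omega) hc.2⟩
    -- The middle node `v (i + 2 ^ j)` has both `v i` and `v (i + 2 ^ j + 2 ^ j)` at level `j + 1`
    -- and introduces them to each other.
    obtain ⟨a1, a2⟩ := base i hi (by omega)
    obtain ⟨b1, b2⟩ := base (i + 2 ^ j) (by omega) (by omega)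
    rw [add_assoc] at b1 b2
    rw [he]
    exact ⟨h.recv_flyConst (s := .left) (ρ := r + j) (h.mem hi (by omega)) (by omega) (by omega) b1 a2
        (Vars.sc_level a1).2.1,
      h.recv_flyConst (s := .right) (ρ := r + j) (h.mem (by omega) (by omega)) (by omega) (by omega) a2 b1
        (Vars.sc_level b2).2.1⟩

/-- In round `r + m` the first `2 ^ m` nodes know the id of `v 1`, and their shortcuts of length `2
^ m` are complete; their tests inform the next `2 ^ m` nodes. A foreign flyover id, once adopted, is
never replaced. -/
theorem flyID_eq_of_le (h : IsStableRun A C r T B v) (hT : r + 1 ≤ T) {m : ℕ} {ρ : ℕ}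
    (h1 : r + m ≤ ρ) (h2 : ρ ≤ T) {i : ℕ} (hi : 1 ≤ i) (hi' : i ≤ B.card) (him : i ≤ 2 ^ m) :
    (inRound A (C ρ) (v i)).flyID = v 1 := by
  have h1B : 1 ≤ B.card := hi.trans hi'
  induction m generalizing ρ i with
  | zero =>
    obtain rfl : i = 1 := by simp at him; omega
    exact (h.root_spec (by omega) h2 hT).2.2
  | succ m ih =>
    by_cases hm : i ≤ 2 ^ m
    · exact ih (by omega) h2 hi hi' hm
    have hp' : 0 < 2 ^ m := by positivity
    have he : 2 ^ (m + 1) = 2 ^ m + 2 ^ m := by ring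
    obtain ⟨i', rfl⟩ : ∃ i', i = i' + 2 ^ m := ⟨i - 2 ^ m, by omega⟩
    have hf := ih (ρ := r + m) le_rfl (by omega) (i := i') (by omega) (by omega) (by omega)
    have hs := (h.shortcuts (j := m) (ρ := r + m) le_rfl (by omega) (i := i') (by omega) hi').1
    have hv := h.mem hi hi'
    have hne1 : v (i' + 2 ^ m) ≠ v 1 := fun hc => by
      have := h.inj hi hi' le_rfl h1B hc; omega
    have h3 := h.recv_testFlyID hv (ρ := r + m) (u := v i') (by omega) (by omega) ?_ ?_ ?_
      (by rwa [hf])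
    · rw [hf] at h3
      obtain ⟨ch, hch⟩ := h.evolve hv (ρ := r + m + 1) (by omega) (by omega) h2
      rcases hch.fly with h4 | h4
      · rw [h4, h3]
      · exact (hne1 (h4.1.symm.trans h3)).elim
    · have hvid := h.vID_eq hT (i := i') (by omega) (by omega) (ρ := r + m) (by omega) (by omega)
      unfold Vars.propFlyID
      rw [hvid, hf]
      by_cases h1 : i' = 1
      · left; simp [h1]
      · right
        refine ⟨by omega, fun hc => h1 ?_⟩
        exact (h.inj le_rfl h1B (by omega) (by omega) hc).symm
    · have := (Vars.sc_level hs).2.2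
      simp only [Vars.S, Finset.mem_union, List.mem_toFinset]
      exact Or.inr this
    · intro hc
      have := h.inj hi hi' (by omega) (by omega) hc
      omega

theorem flyID_eq (h : IsStableRun A C r T B v) {ρ : ℕ} (h1 : r + Nat.clog 2 B.card ≤ ρ)
    (h2 : ρ ≤ T) {i : ℕ} (hi : 1 ≤ i) (hi' : i ≤ B.card) :
    (inRound A (C ρ) (v i)).flyID = v 1 := by
  have := Nat.clog_pos one_lt_two h.spine.two_le
  exact h.flyID_eq_of_le (by omega) h1 h2 hi hi' (hi'.trans (Nat.le_pow_clog one_lt_two _))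

theorem isSpineOf (h : IsStableRun A C r T B v) {ρ : ℕ} (h1 : r ≤ ρ) (h2 : ρ ≤ T)
    (hT : r + 1 ≤ T) : IsSpineOf (inRound A (C ρ)) B v where
  two_le := h.spine.two_le
  bij := h.spine.bij
  left_wing := Or.inl (h.root_spec h1 h2 hT).1
  right_wing := Or.inl (h.right_end_persists h1 h2)
  spine i hi hi' := h.shortcuts (j := 0) h1 h2 hi (by have := h.spine.two_le; simp; omega)

theorem isFlyover (h : IsStableRun A C r T B v) {ρ : ℕ} (h1 : r + Nat.clog 2 B.card ≤ ρ)
    (h2 : ρ ≤ T) : IsFlyover (inRound A (C ρ)) B := by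
  have hk := Nat.clog_pos one_lt_two h.spine.two_le
  refine ⟨v, h.isSpineOf (by omega) h2 (by omega), fun i hi hi' => ?_, fun i hi hi' j hj hj' => ?_⟩
  · rw [h.vID_eq (by omega) (by omega) (by omega) (by omega) h2,
      h.vID_eq (by omega) hi (by omega) (by omega) h2]
    push_cast; rfl
  · obtain ⟨j, rfl⟩ : ∃ j', j = j' + 1 := ⟨j - 1, by omega⟩
    have h3 : j ≤ Nat.log 2 (B.card - i) := by omega
    have h4 : 2 ^ j ≤ B.card - i := (Nat.pow_le_pow_right two_pos h3).trans
      (Nat.pow_log_le_self 2 (by omega))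
    -- The levels demanded of a flyover are at most `Nat.clog 2 B.card + 1`, and level `j + 1` is
    -- complete in round `r + j`.
    have h5 : Nat.log 2 (B.card - i) ≤ Nat.clog 2 B.card :=
      (Nat.log_mono_right (Nat.sub_le _ _)).trans (Nat.log_le_clog 2 _)
    exact h.shortcuts (by omega) h2 hi (by omega)

end IsStableRun

end Execution

/-! ### Properties of the next stop -/

section NextStop

variable {V : Type*} [LinearOrder V]

theorem Vars.closest_spec {x : Vars V} {s : Side} {sgn val : ℤ} {z : V}
    (h : x.closest s sgn val = some z) : ∃ j, x.sc s j = some z ∧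
      ∀ j', 1 ≤ j' → j' ≤ (x.short s).length →
        |x.vID + sgn * 2 ^ (j - 1) - val| ≤ |x.vID + sgn * 2 ^ (j' - 1) - val| := by
  obtain ⟨j, hj, hz⟩ := Option.bind_eq_some_iff.1 h
  refine ⟨j, hz, fun j' h1 h2 => ?_⟩
  have := List.le_of_mem_argmin (mem_levels h1 h2) hj
  simp only [Int.abs_eq_natAbs]
  exact_mod_cast this

theorem Vars.nextStop_spec {x : Vars V} {val : ℤ} {z : V} (h : x.nextStop val = some z) :
    1 ≤ val ∧ ((x.vID < val ∧ x.R ≠ [] ∧ x.closest .right 1 val = some z) ∨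
      (val < x.vID ∧ x.closest .left (-1) val = some z)) := by
  unfold Vars.nextStop at h
  split_ifs at h with h1 h2 h3 h4
  · exact ⟨by omega, Or.inl ⟨h4, fun hc => h3 (Or.inl ⟨h4, hc⟩), h⟩⟩
  · exact ⟨by omega, Or.inr ⟨by omega, h⟩⟩

end NextStop

/-! ### Routing of certificates -/

section Certificates

variable {V M X : Type*} [Fintype V] [LinearOrder V] {A : BaseAlgorithm V M X}
  {C : ℕ → Config V M X}

namespace IsStableRun

variable {r T : ℕ} {B : Finset V} {v : ℕ → V}

/-- A new entry at level `l + 1` was announced by a node that is the recipient's own entry at level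
`l`, hence in `B` by induction on the level; the announced id was a shortcut of that node one round
earlier, hence in `B` by induction on the round. -/
theorem sc_mem (h : IsStableRun A C r T B v) (hS : ∀ u ∈ B, (inRound A (C r) u).S ⊆ B) {ρ : ℕ}
    (h1 : r ≤ ρ) (h2 : ρ ≤ T) {u : V} (hu : u ∈ B) {s : Side} {l : ℕ} {z : V}
    (hz : (inRound A (C ρ) u).sc s l = some z) : z ∈ B := by
  induction ρ, h1 using Nat.le_induction generalizing u s l z with
  | base =>
    refine hS u hu ?_
    have := (Vars.sc_level hz).2.2
    cases s <;> simp only [Vars.short] at this <;> simp [Vars.S, this]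
  | succ ρ h1 ih =>
    induction l generalizing z with
    | zero => simp [Vars.sc] at hz
    | succ l ihl =>
      rcases (h.step hu h1 h2).origin s l z hz with h3 | ⟨sen, h3, h4⟩
      · exact ih (by omega) hu h3
      · have h5 := h.exec.flyConst_origin (h.one_le.trans h1) h3
        exact ih (by omega) (ihl h4) h5

/-- The recipient of the virtual-id test is in `B`, where virtual ids are positions in the backbone,
so the test determines the recipient. -/
theorem sc_eq (h : IsStableRun A C r T B v) (hS : ∀ u ∈ B, (inRound A (C r) u).S ⊆ B) {ρ : ℕ}
    (h1 : r ≤ ρ) (h2 : ρ + 1 ≤ T) {i : ℕ} (hi : 1 ≤ i) (hi' : i ≤ B.card) {s : Side} {l : ℕ} {z : V}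
    (hz : (inRound A (C ρ) (v i)).sc s l = some z) :
    ∃ i', 1 ≤ i' ∧ i' ≤ B.card ∧ z = v i' ∧ (i' : ℤ) = i + s.sgn * 2 ^ (l - 1) := by
  have hzB := h.sc_mem hS h1 (by omega) (h.mem hi hi') hz
  have h3 := h.recv_testVID hzB h1 h2 hz
  obtain ⟨i', h4, h5, rfl⟩ := h.exists_index hzB
  rw [h.vID_eq (by omega) h4 h5 (by omega) h2, h.vID_eq (by omega) hi hi' h1 (by omega)] at h3
  exact ⟨i', h4, h5, rfl, h3⟩

/-- A hop from `v i` towards the virtual id `x` halves the distance to the target. -/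
theorem nextStop_halves (h : IsStableRun A C r T B v) (hS : ∀ u ∈ B, (inRound A (C r) u).S ⊆ B)
    {ρ : ℕ} (h1 : r + Nat.clog 2 B.card ≤ ρ) (h2 : ρ + 1 ≤ T) {i : ℕ} (hi : 1 ≤ i)
    (hi' : i ≤ B.card) {x : ℤ} {z : V} (hz : (inRound A (C ρ) (v i)).nextStop x = some z) {m : ℕ}
    (hm : |min x B.card - i| < 2 ^ (m + 1)) :
    ∃ i', 1 ≤ i' ∧ i' ≤ B.card ∧ z = v i' ∧ |min x B.card - i'| < 2 ^ m := by
  have hk := Nat.clog_pos one_lt_two h.spine.two_le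
  have hvid := h.vID_eq (by omega) hi hi' (ρ := ρ) (by omega) (by omega)
  obtain ⟨hx1, hc⟩ := Vars.nextStop_spec hz
  rw [hvid] at hc
  -- The largest power of two not exceeding the distance `D`: its level is already complete, and a
  -- hop of this length leaves less than that power.
  have hlog : ∀ D : ℕ, 0 < D → D < B.card → (D : ℤ) < 2 ^ (m + 1) →
      ∃ l, 2 ^ l ≤ D ∧ D < 2 ^ l + 2 ^ l ∧ (2 ^ l : ℕ) ≤ 2 ^ m ∧ r + l ≤ ρ := by
    intro D hD hDn hDm
    have hDm' : D < 2 ^ (m + 1) := by exact_mod_cast hDm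
    refine ⟨Nat.log 2 D, Nat.pow_log_le_self 2 hD.ne', ?_, ?_, ?_⟩
    · have := Nat.lt_pow_succ_log_self one_lt_two D
      rw [Nat.succ_eq_add_one, pow_succ] at this
      omega
    · refine Nat.pow_le_pow_right two_pos ?_
      have := Nat.log_lt_of_lt_pow hD.ne' hDm'
      omega
    · have h3 : Nat.log 2 D ≤ Nat.clog 2 B.card :=
        (Nat.log_mono_right hDn.le).trans (Nat.log_le_clog 2 _)
      omega
  rcases hc with ⟨hlt, hR, hc⟩ | ⟨hlt, hc⟩
  · have hin : i < B.card := by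
      refine lt_of_le_of_ne hi' fun hcon => hR ?_
      rw [hcon]
      exact h.right_end_persists (by omega) (by omega)
    obtain ⟨j, hj, hmin⟩ := Vars.closest_spec hc
    obtain ⟨i', h3, h4, rfl, h5⟩ := h.sc_eq hS (by omega) h2 hi hi' hj
    refine ⟨i', h3, h4, rfl, ?_⟩
    rw [hvid] at hmin
    simp only [Side.sgn] at h5
    rw [← h5] at hmin
    -- The target `x` may exceed `B.card`. Being closest to `x`, the chosen hop goes at least as far
    -- as the level-`l + 1` one in that case, but cannot leave `B`, so the distance to `B.card`
    -- shrinks.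
    obtain ⟨D, hD⟩ : ∃ D : ℕ, (D : ℤ) = min x B.card - i := ⟨(min x B.card - i).toNat, by omega⟩
    rw [← hD, Nat.abs_cast] at hm
    obtain ⟨l, hl1, hl2, hl3, hl4⟩ := hlog D (by omega) (by omega) hm
    have h6 := (Vars.sc_level (h.shortcuts hl4 (by omega) hi (by omega)).1).2.1
    have h7 := hmin (l + 1) (by omega) h6
    rw [Nat.add_sub_cancel] at h7
    zify at hl1 hl2 hl3
    rw [abs_lt]
    rw [abs_le'] at h7
    generalize (2 : ℤ) ^ l = a at *
    generalize (2 : ℤ) ^ m = b at *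
    have h8 : |(i : ℤ) + 1 * a - x| = x - i - a := by rw [abs_of_nonpos] <;> omega
    rw [h8] at h7
    constructor <;> omega
  · obtain ⟨j, hj, hmin⟩ := Vars.closest_spec hc
    obtain ⟨i', h3, h4, rfl, h5⟩ := h.sc_eq hS (by omega) h2 hi hi' hj
    refine ⟨i', h3, h4, rfl, ?_⟩
    rw [hvid] at hmin
    simp only [Side.sgn] at h5
    rw [← h5] at hmin
    have hmx : min x (B.card : ℤ) = x := by omega
    rw [hmx] at hm ⊢
    obtain ⟨D, hD⟩ : ∃ D : ℕ, (D : ℤ) = i - x := ⟨(i - x).toNat, by omega⟩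
    rw [abs_sub_comm, ← hD, Nat.abs_cast] at hm
    obtain ⟨l, hl1, hl2, hl3, hl4⟩ := hlog D (by omega) (by omega) hm
    have h6 := (h.shortcuts hl4 (by omega) (i := i - 2 ^ l) (by omega) (by omega)).2
    rw [Nat.sub_add_cancel (by omega)] at h6
    have h7 := hmin (l + 1) (by omega) (Vars.sc_level h6).2.1
    rw [Nat.add_sub_cancel] at h7
    zify at hl1 hl2 hl3
    rw [abs_lt]
    rw [abs_le'] at h7
    generalize (2 : ℤ) ^ l = a at *
    generalize (2 : ℤ) ^ m = b at *
    have h8 : |(i : ℤ) + -1 * a - x| = i - x - a := by rw [abs_of_nonneg] <;> omega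
    rw [h8] at h7
    constructor <;> omega

/-- From this round on every node of `B` forwards certificates instead of flushing them. -/
theorem propFlyID (h : IsStableRun A C r T B v) {ρ : ℕ} (h1 : r + Nat.clog 2 B.card ≤ ρ)
    (h2 : ρ ≤ T) {i : ℕ} (hi : 1 ≤ i) (hi' : i ≤ B.card) :
    (inRound A (C ρ) (v i)).propFlyID (v i) := by
  have hk := Nat.clog_pos one_lt_two h.spine.two_le
  unfold Vars.propFlyID
  rw [h.vID_eq (by omega) hi hi' (by omega) h2, h.flyID_eq h1 h2 hi hi']
  by_cases h3 : i = 1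
  · left; simp [h3]
  · exact Or.inr ⟨by omega, fun hc => h3 (h.inj le_rfl (by omega) hi hi' hc).symm⟩

/-- A certificate message reaches the node closest to its target. -/
theorem testCert_reaches (h : IsStableRun A C r T B v)
    (hS : ∀ u ∈ B, (inRound A (C r) u).S ⊆ B) {y : V} {x d : ℤ} {q : ℕ}
    (hq : (q : ℤ) = min x B.card) {m ρ : ℕ} (h1 : r + Nat.clog 2 B.card ≤ ρ) (h2 : ρ + m ≤ T)
    {i : ℕ} (hi : 1 ≤ i) (hi' : i ≤ B.card) (hm : |min x B.card - i| < 2 ^ m)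
    (hmsg : Msg.testCert y x d ∈ (C ρ).chan (v i)) :
    ∃ ρ', ρ ≤ ρ' ∧ ρ' ≤ ρ + m ∧ Msg.testCert y x d ∈ (C ρ').chan (v q) := by
  have hk := Nat.clog_pos one_lt_two h.spine.two_le
  induction m generalizing ρ i with
  | zero =>
    obtain rfl : i = q := by
      rw [pow_zero, abs_lt] at hm
      omega
    exact ⟨ρ, le_rfl, le_rfl, hmsg⟩
  | succ m ih =>
    by_cases hx : x = i
    · obtain rfl : i = q := by omega
      exact ⟨ρ, le_rfl, by omega, hmsg⟩
    have hv := h.mem hi hi'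
    have hvid := h.vID_eq (by omega) hi hi' (ρ := ρ) (by omega) (by omega)
    obtain ⟨z, hz, hout⟩ := (h.keeps ρ (by omega) (by omega) _ hv).spec.2.testCert_ne y x d hmsg
      (h.chan_not_noS hv (by omega) (by omega)) (by
        intro hc
        exact hx (hc.symm.trans hvid))
    obtain ⟨i', h3, h4, rfl, h5⟩ := h.nextStop_halves hS h1 (by omega) hi hi' hz hm
    obtain ⟨ρ', h6, h7, h8⟩ := ih (ρ := ρ + 1) (by omega) (by omega) h3 h4 h5
      (h.exec.deliver (by omega) (mem_endOfRound_of_mem_afterResponses A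
        (hout (h.propFlyID h1 (by omega) hi hi'))))
    exact ⟨ρ', by omega, by omega, h8⟩

/-- Every node but the first has a parent, which knows it and which it knows. -/
theorem exists_parent (h : IsStableRun A C r T B v) (hS : ∀ u ∈ B, (inRound A (C r) u).S ⊆ B)
    (hT : r + 2 * Nat.clog 2 B.card + 1 ≤ T) {i : ℕ} (hi : 2 ≤ i) (hi' : i ≤ B.card) :
    ∃ q, 1 ≤ q ∧ q ≤ B.card ∧ ∀ ρ, r + 2 * Nat.clog 2 B.card + 1 ≤ ρ → ρ ≤ T →
      (inRound A (C ρ) (v i)).cpar = q ∧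
      (inRound A (C ρ) (v i)).cdist = (inRound A (C ρ) (v q)).cdist + 1 ∧
      v i ∈ (inRound A (C ρ) (v q)).cids ∧ v q ∈ (inRound A (C ρ) (v i)).cids := by
  obtain ⟨k, hk⟩ : ∃ k, Nat.clog 2 B.card = k + 1 :=
    ⟨Nat.clog 2 B.card - 1, by have := Nat.clog_pos one_lt_two h.spine.two_le; omega⟩
  have hBk : (B.card : ℤ) ≤ 2 ^ (k + 1) := by
    have := Nat.le_pow_clog one_lt_two B.card
    rw [hk] at this
    exact_mod_cast this
  have hv := h.mem (i := i) (by omega) hi'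
  set ρ₀ := r + Nat.clog 2 B.card with hρ₀
  have hvid := h.vID_eq (by omega) (i := i) (by omega) hi' (ρ := ρ₀) (by omega) (by omega)
  obtain ⟨z, hz⟩ := Option.ne_none_iff_exists'.1 ((h.checks hv (ρ := ρ₀) (by omega)
    (by omega)).nextStop (h.not_noS hv (by omega) (by omega)) (by omega))
  have hx1 := (Vars.nextStop_spec hz).1
  obtain ⟨q, hq⟩ : ∃ q : ℕ, (q : ℤ) = min (inRound A (C ρ₀) (v i)).cpar B.card := ⟨(min (inRound A (C ρ₀) (v i)).cpar B.card).toNat, by omega⟩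
  -- Both numbers lie between `1` and `B.card`, so they differ by less than `B.card`.
  have hD : |min (inRound A (C ρ₀) (v i)).cpar B.card - i| < 2 ^ (k + 1) := by
    rw [abs_lt]; constructor <;> omega
  obtain ⟨i', h3, h4, rfl, h5⟩ := h.nextStop_halves hS (ρ := ρ₀) le_rfl (by omega) (by omega) hi'
    hz hD
  have hfly : (inRound A (C ρ₀) (v i)).flyID ≠ v i := by
    rw [h.flyID_eq (ρ := ρ₀) le_rfl (by omega) (by omega) hi']
    intro hc
    have := h.inj le_rfl (by omega) (by omega) hi' hc
    omega
  have hmsg := h.exec.deliver (ρ := ρ₀) (by have := h.one_le; omega)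
    ((endOfRound_testsSpec A (C ρ₀) (v i)).testCert (by rw [hvid]; omega) hfly _ hz)
  -- The first hop has used up one halving, so `k` remain with `Nat.clog 2 B.card = k + 1`, and `ρ₁`
  -- is at most `r + 2 * Nat.clog 2 B.card`.
  obtain ⟨ρ₁, ha, hb, hmsg'⟩ := h.testCert_reaches hS hq (ρ := ρ₀ + 1) (by omega) (by omega) h3 h4
    h5 hmsg
  have hq1 : 1 ≤ q := by omega
  have hq2 : q ≤ B.card := by omega
  have hvq := h.mem hq1 hq2
  have hspec := (h.keeps ρ₁ (by omega) (by omega) _ hvq).spec.2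
  have hns := h.chan_not_noS hvq (ρ := ρ₁) (by omega) (by omega)
  have hvidq := h.vID_eq (by omega) hq1 hq2 (ρ := ρ₁) (by omega) (by omega)
  -- Otherwise `q = B.card` and the target lies further right, where the last node has no shortcut;
  -- the missing next stop would set `exit`.
  have hqx : (q : ℤ) = (inRound A (C ρ₀) (v i)).cpar := by
    by_contra hc
    obtain ⟨w, hw, -⟩ := hspec.testCert_ne _ _ _ hmsg' hns (by
      intro hc'
      exact hc (hvidq.symm.trans hc'))
    obtain ⟨-, h6 | h6⟩ := Vars.nextStop_spec hw
    · refine h6.2.1 ?_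
      obtain rfl : q = B.card := by omega
      exact h.right_end_persists (by omega) (by omega)
    · have h7 : (inRound A (C ρ₀) (v i)).cpar < (inRound A (C ρ₁) (v q)).vID := h6.1
      omega
  obtain ⟨h6, h7, h8⟩ := hspec.testCert_eq _ _ _ hmsg' hns (hvidq.trans hqx)
  have hmsg2 := h.exec.deliver (ρ := ρ₁) (by have := h.one_le; omega)
    (mem_endOfRound_of_mem_afterResponses A h8)
  have h9 := (h.keeps (ρ₁ + 1) (by omega) (by omega) _ hv).spec.2.introCert _ hmsg2
  refine ⟨q, hq1, hq2, fun ρ hρ hρT => ?_⟩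
  obtain ⟨ch, e0⟩ := h.evolve hv (ρ := ρ₀) (ρ' := ρ) (by omega) (by omega) hρT
  obtain ⟨ch', e1⟩ := h.evolve hvq (ρ := ρ₁) (ρ' := ρ) (by omega) (by omega) hρT
  obtain ⟨ch'', e2⟩ := h.evolve hv (ρ := ρ₁ + 1) (ρ' := ρ) (by omega) (by omega) hρT
  refine ⟨by rw [e0.cpar, hqx], ?_, e1.cids h7, e2.cids h9⟩
  rw [e0.cdist, e1.cdist]
  have h10 : (inRound A (C ρ₀) (v i)).cdist - 1 = (inRound A (C ρ₁) (v q)).cdist := h6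
  omega

end IsStableRun
end Certificates

/-! ### Correct configuration -/

section Configuration

variable {V M X : Type*} [Fintype V] [LinearOrder V] {A : BaseAlgorithm V M X}
  {C : ℕ → Config V M X}

namespace IsStableRun

variable {r T : ℕ} {B : Finset V} {v : ℕ → V}

/-- In a backbone on `insert u B` the node `u` would be the level-1 shortcut of a member of `B`. But
the level-1 shortcuts of members lead to members, and the two ends have none on their outer side. -/
theorem isMaximalBackbone (h : IsStableRun A C r T B v) {ρ : ℕ} (h1 : r ≤ ρ) (h2 : ρ ≤ T)
    (hT : r + 1 ≤ T) : IsMaximalBackbone (inRound A (C ρ)) B := by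
  have hs := h.isSpineOf h1 h2 hT
  refine ⟨⟨v, hs⟩, ?_⟩
  rintro u hu ⟨v', hv'⟩
  have hn := h.spine.two_le
  have hcard := Finset.card_insert_of_notMem hu
  have hbij := hv'.bij
  have hspine := hv'.spine
  rw [hcard] at hbij hspine
  obtain ⟨p, ⟨hp1, hp2⟩, hp⟩ := hbij.surjOn (Finset.mem_coe.2 (Finset.mem_insert_self u B))
  have mem : ∀ i, 1 ≤ i → i ≤ B.card + 1 → i ≠ p → v' i ∈ B := by
    intro i hi hi' hip
    refine (Finset.mem_insert.1 (Finset.mem_coe.1 (hbij.mapsTo ⟨hi, hi'⟩))).resolve_left ?_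
    intro hc
    exact hip (hbij.injOn ⟨hi, hi'⟩ ⟨hp1, hp2⟩ (hc.trans hp.symm))
  by_cases hpl : p = B.card + 1
  · have h3 := (hspine (p - 1) (by omega) (by omega)).1
    rw [Nat.sub_add_cancel hp1, hp] at h3
    obtain ⟨i, hi, hi', he⟩ := h.exists_index (mem (p - 1) (by omega) (by omega) (by omega))
    rw [← he] at h3
    by_cases hiB : i = B.card
    · rw [hiB] at h3
      simp [Vars.sc, Vars.short, h.right_end_persists h1 h2] at h3
    · rw [(hs.spine i hi (by omega)).1] at h3
      cases h3
      exact hu (h.mem (by omega) (by omega))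
  · have h3 := (hspine p hp1 (by omega)).2
    rw [hp] at h3
    obtain ⟨i, hi, hi', he⟩ := h.exists_index (mem (p + 1) (by omega) (by omega) (by omega))
    rw [← he] at h3
    by_cases hi1 : i = 1
    · rw [hi1] at h3
      simp [Vars.sc, Vars.short, (h.root_spec h1 h2 hT).1] at h3
    · have h4 := (hs.spine (i - 1) (by omega) (by omega)).2
      rw [Nat.sub_add_cancel hi] at h4
      rw [h4] at h3
      cases h3
      exact hu (h.mem (by omega) (by omega))

theorem cdist_eq (h : IsStableRun A C r T B v) {u : V} (hu : u ∈ B) {ρ : ℕ} (h1 : r ≤ ρ)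
    (h2 : ρ ≤ T) : (inRound A (C ρ) u).cdist = (inRound A (C r) u).cdist := by
  obtain ⟨ch, hch⟩ := h.evolve hu le_rfl h1 h2
  exact hch.cdist

theorem cdist_nonneg (h : IsStableRun A C r T B v) (hT : r + 1 ≤ T) {u : V} (hu : u ∈ B) :
    0 ≤ (inRound A (C r) u).cdist := by
  obtain ⟨i, hi, hi', rfl⟩ := h.exists_index hu
  have hc := h.checks hu le_rfl hT
  have hv := h.vID_eq hT hi hi' le_rfl (by omega)
  by_cases h1 : i = 1
  · exact (hc.cdist_root (by rw [hv, h1]; rfl)).ge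
  · exact (hc.cdist_pos (by rw [hv]; omega)).le

/-- Of two ids in `c-ids` different from that of the node, one is smaller and one is larger. -/
theorem cids_between (h : IsStableRun A C r T B v) {ρ : ℕ} (h1 : r ≤ ρ) (h2 : ρ + 1 ≤ T)
    {a b c : V} (ha : a ∈ B) (hb : b ∈ (inRound A (C ρ) a).cids)
    (hc : c ∈ (inRound A (C ρ) a).cids) (hba : b ≠ a) (hca : c ≠ a) (hbc : b < c) :
    b < a ∧ a < c := by
  have hck := h.checks ha h1 h2
  have hsub : {b, c} ⊆ (inRound A (C ρ) a).cids := by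
    intro y hy
    simp only [Finset.mem_insert, Finset.mem_singleton] at hy
    rcases hy with rfl | rfl <;> assumption
  have hcard : ({b, c} : Finset V).card = 2 := Finset.card_pair hbc.ne
  have heq := Finset.eq_of_subset_of_card_le hsub (by rw [hcard]; exact hck.card_le)
  have h3 := hck.not_lt (heq ▸ hcard)
  have h4 := hck.not_gt (heq ▸ hcard)
  rw [← heq] at h3 h4
  simp only [Finset.mem_insert, Finset.mem_singleton, forall_eq_or_imp, forall_eq] at h3 h4
  constructor
  · exact hba.lt_or_gt.resolve_right fun hlt => h4 ⟨hlt, hlt.trans hbc⟩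
  · exact hca.lt_or_gt.resolve_left fun hlt => h3 ⟨hbc.trans hlt, hlt⟩

theorem isCorrectlyConfigured (h : IsStableRun A C r T B v)
    (hS : ∀ u ∈ B, (inRound A (C r) u).S ⊆ B) {ρ : ℕ} (h1 : r + 3 * Nat.clog 2 B.card ≤ ρ)
    (h2 : ρ ≤ T) : IsCorrectlyConfigured (inRound A (C ρ)) B := by
  have hn := h.spine.two_le
  have hk := Nat.clog_pos one_lt_two hn
  set root : B := ⟨v 1, h.mem le_rfl (by omega)⟩ with hroot
  -- Stated for the root as well, with a dummy parent, so that `choose` yields a total parent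
  -- function.
  have hpar : ∀ a : B, ∃ q : B, a ≠ root → ∀ ρ, r + 2 * Nat.clog 2 B.card + 1 ≤ ρ → ρ ≤ T →
      (inRound A (C ρ) a).cpar = (inRound A (C ρ) q).vID ∧
      (inRound A (C ρ) a).cdist = (inRound A (C ρ) q).cdist + 1 ∧
      (a : V) ∈ (inRound A (C ρ) q).cids ∧ (q : V) ∈ (inRound A (C ρ) a).cids := by
    rintro ⟨a, ha⟩
    obtain ⟨i, hi, hi', rfl⟩ := h.exists_index ha
    by_cases hi1 : i = 1
    · subst hi1
      exact ⟨root, fun hc => (hc rfl).elim⟩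
    · obtain ⟨q, hq, hq', hspec⟩ := h.exists_parent hS (by omega) (i := i) (by omega) hi'
      refine ⟨⟨v q, h.mem hq hq'⟩, fun _ ρ ha hb => ?_⟩
      have := hspec ρ ha hb
      dsimp only
      rwa [h.vID_eq (by omega) hq hq' (by omega) hb]
  choose p hp using hpar
  -- The frozen c-dist values serve as depth; they are nonnegative, so `toNat` loses nothing.
  set d : B → ℕ := fun a => (inRound A (C r) a).cdist.toNat with hd
  have hdc : ∀ ρ, r ≤ ρ → ρ ≤ T → ∀ a : B, (inRound A (C ρ) a).cdist = d a := by
    intro ρ h1 h2 a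
    rw [h.cdist_eq a.2 h1 h2, hd]
    have := h.cdist_nonneg (by omega) a.2
    dsimp only
    omega
  have hdr : d root = 0 := by
    have h3 := (h.checks root.2 le_rfl (by omega)).cdist_root
      (h.root_spec le_rfl (by omega) (by omega)).2.1
    simp [hd, h3]
  have hdp : ∀ a, a ≠ root → d a = d (p a) + 1 := by
    intro a ha
    have h3 := (hp a ha T (by omega) le_rfl).2.1
    rw [hdc T (by omega) le_rfl, hdc T (by omega) le_rfl] at h3
    exact_mod_cast h3
  have hnb : ∀ a b : B, (a ≠ root ∧ p a = b) ∨ (b ≠ root ∧ p b = a) →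
      b ≠ a ∧ ∀ ρ, r + 2 * Nat.clog 2 B.card + 1 ≤ ρ → ρ ≤ T →
        (b : V) ∈ (inRound A (C ρ) a).cids := by
    rintro a b (⟨h3, rfl⟩ | ⟨h3, rfl⟩)
    · refine ⟨fun hc => ?_, fun ρ ha hb => (hp a h3 ρ ha hb).2.2.2⟩
      have := hdp a h3
      rw [hc] at this
      omega
    · refine ⟨fun hc => ?_, fun ρ ha hb => (hp b h3 ρ ha hb).2.2.1⟩
      have := hdp b h3
      rw [← hc] at this
      omega
  have htree : SortedTree root p d := by
    refine ⟨hdr, hdp, fun a b c hb hc hbc => ?_⟩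
    obtain ⟨hba, hb⟩ := hnb a b hb
    obtain ⟨hca, hc⟩ := hnb a c hc
    -- The c-ids of round `r + 2 * k + 1` are checked one round later, and `r + 2 * k + 2 ≤ r + 3 *
    -- k` needs `k ≥ 2`, where `k` is `Nat.clog 2 B.card`. Two distinct tree neighbours of a node
    -- force `B.card ≥ 3`, which gives exactly this.
    have h3 : 2 < B.card := by
      have h4 : ({(a : V), (b : V), (c : V)} : Finset V).card = 3 := Finset.card_eq_three.2
        ⟨a, b, c, fun h => hba (Subtype.ext h.symm), fun h => hca (Subtype.ext h.symm),
          fun h => hbc.ne (Subtype.ext h), rfl⟩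
      have h5 : ({(a : V), (b : V), (c : V)} : Finset V) ⊆ B := by
        simp [Finset.insert_subset_iff]
      have := Finset.card_le_card h5
      omega
    have h4 : 1 < Nat.clog 2 B.card := (Nat.lt_clog_iff_pow_lt one_lt_two).2 (by simpa using h3)
    exact h.cids_between (ρ := r + 2 * Nat.clog 2 B.card + 1) (by omega) (by omega) a.2
      (hb _ le_rfl (by omega)) (hc _ le_rfl (by omega)) (fun hc => hba (Subtype.ext hc))
      (fun hc => hca (Subtype.ext hc)) hbc
  have hadj : ∀ a b, (sortedPath B).Adj a b ↔ (a ≠ root ∧ p a = b) ∨ (b ≠ root ∧ p b = a) :=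
    fun a b => sortedPath_adj.trans htree.adj_iff
  have hdist := dist_root_eq_depth hdp hdr hadj
  refine ⟨h.isMaximalBackbone (by omega) h2 (by omega), v, h.isSpineOf (by omega) h2 (by omega),
    fun i hi hi' => ⟨h.vID_eq (by omega) hi hi' (by omega) h2, h.flyID_eq (by omega) h2 hi hi'⟩,
    fun a b hab => (hnb a b ((hadj a b).1 hab)).2 ρ (by omega) h2,
    sortedPath B, root, le_rfl, isTree_of_parent hdp hdr hadj, rfl, fun a ha => ⟨p a, ⟨?_, ?_⟩, ?_⟩,
    fun a => ?_⟩
  · exact (hadj _ _).2 (Or.inl ⟨ha, rfl⟩)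
  · rw [hdist, hdist, hdp a ha]
  · exact (hp a ha ρ (by omega) h2).1
  · rw [hdist, hdc ρ (by omega) h2]

end IsStableRun

end Configuration

end Overlay

/-! ### The theorem -/

open Overlay in
theorem mainTheorem6 {V M X : Type*} [Fintype V] [LinearOrder V] (A : BaseAlgorithm V M X)
    (C : ℕ → Config V M X) (hC : IsExecution A C) (r T : ℕ) (hr : 5 < r) (B : Finset V)
    (hB : IsMaximalBackbone (inRound A (C r)) B) (hw : ¬ IsWinged (inRound A (C r)) B)
    (hexit : ∀ ρ, r ≤ ρ → ρ ≤ T → ∀ u ∈ B, KeepsExitZero A (C ρ) u) :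
    (r + 2 * Nat.clog 2 B.card ≤ T →
      ∀ r', r + 2 * Nat.clog 2 B.card ≤ r' → r' ≤ T →
        IsFlyover (inRound A (C r')) B ∧
        ∃ v ∈ B, (inRound A (C r') v).L = [] ∧ ∀ u ∈ B, (inRound A (C r') u).flyID = v) ∧
    (r + 3 * Nat.clog 2 B.card ≤ T →
      (∀ u ∈ B, (inRound A (C r) u).S ⊆ B) →
      ∀ r', r + 3 * Nat.clog 2 B.card ≤ r' → r' ≤ T →
        IsCorrectlyConfigured (inRound A (C r')) B) := by
  obtain ⟨⟨v, hv⟩, -⟩ := hB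
  have hn := hv.two_le
  have hk := Nat.clog_pos one_lt_two hn
  have h : IsStableRun A C r T B v :=
    ⟨hC, by omega, hv, by_contra fun hc => hw ⟨v, hv, Or.inl hc⟩,
      by_contra fun hc => hw ⟨v, hv, Or.inr hc⟩, hexit⟩
  -- The first claim already holds from round `r + Nat.clog 2 B.card` on.
  refine ⟨fun _ r' h1 h2 => ⟨h.isFlyover (by omega) h2, v 1, h.mem le_rfl (by omega),
    (h.root_spec (by omega) h2 (by omega)).1, fun u hu => ?_⟩,
    fun _ hS r' h1 h2 => h.isCorrectlyConfigured hS h1 h2⟩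
  obtain ⟨i, hi, hi', rfl⟩ := h.exists_index hu
  exact h.flyID_eq (by omega) h2 hi hi'
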